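/- **Setting.** Let $X$ be a real Banach space, $\kappa$ a linearly ordered set (for instance an infinite cardinal), $(d_\alpha)_{\alpha\in\kappa}$ a family in $X$ (in the usual construction it is dense in $X$), $X_t=\operatorname{span}\{d_\alpha:\alpha\in t\}$, and let $\lambda>1$, $\eta<1$ with $\lambda\eta>1$. Order the finite subsets of $\kappa$ by the anti-lexicographic order $\prec$ (compare maxima first, then remove them and repeat). A *general realization* of the Lopez-Abad construction consists of the following. * For every nonempty finite $t\subset\kappa$: an integer $n_t$ and a proper subspace $S_t\subsetneq\ell_\infty^{n_t}$. * For every finite $s$, a local system $(E^{(s)}_t)_{t\subseteq s}$ with $E^{(s)}_\emptyset=X$. For $\emptyset\ne t\subseteq s$, with $\bar t$ the immediate $\prec$-predecessor of $t$ among the subsets of $s$, $$E^{(s)}_t=(\ell_\infty^{n_t}\oplus_1E^{(s)}_{\bar t})/\{(\xi,-\nu_t(\xi)):\xi\in S_t\},$$ where $\nu_t=\nu^{(s)}_t:S_t\to Y_t$ is a linear bijection with $\|\nu_t\|\le\eta$ and $\|\nu_t^{-1}\|\le\lambda$. The isometric embeddings $j^{(s)}_{u,t}:E_u^{(s)}\to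 E_t^{(s)}$ ($u\preceq t$) are the compositions of the maps $e\mapsto[(0,e)]$. Further, $G^{(s)}_t=\{[(x,0)]:x\in\ell_\infty^{n_t}\}$, and $Y_t\subseteq E^{(s)}_{\bar t}$ is the span of the images of $X_t$ and of all $G^{(s)}_u$ with $\emptyset\ne u\subsetneq t$. * Isometric transition maps $k^{(t,s)}_u:E^{(t)}_u\to E^{(s)}_u$ ($u\subseteq t\subseteq s$) that fix $X$, send $[(x,0)]$ to $[(x,0)]$ and commute with the $j$'s. Put $E_t=E_t^{(t)}$, $G_t=G_t^{(t)}$ and $j_{t,s}=j^{(s)}_{t,s}\circ k^{(t,s)}_t:E_t\to E_s$ for $t\subseteq s$. A subspace of $\ell_\infty^n$ is *coordinate* if it is spanned by standard basis vectors. **Proposition 9.3.** In a general realization the upper bound $\|\sum_i a_i\,j_{s_i,\sigma}(v_i)\|\le\lambda\max_i|a_i|$ can fail. Precisely, let $1<\lambda<\sqrt2$, $\eta<1<\lambda\eta$, let $\gamma_1<\gamma_2$ in $\kappa$ with $d_{\gamma_1},d_{\gamma_2}\neq0$, and put $s_i=\{\gamma_i\}$, $\sigma=\{\gamma_1,\gamma_2\}$.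 Then there is a general realization with these $X,(d_\alpha),\lambda,\eta$ such that: 1. For $i=1,2$: $n_{s_i}=2$ and $S_{s_i}=\operatorname{span}\{e_1+e_2\}\subset\ell_\infty^2$, which is not a coordinate subspace. 2. The functional $f_i([(b,e)])=(b_1-b_2)/2$ is well defined on $E_{s_i}$ with $\|f_i\|=1$, and $v_i=[(e_1-e_2,0)]\in G_{s_i}$ satisfies $f_i(v_i)=1$ and $\|v_i\|\le\lambda$. Moreover there are functionals $F_1,F_2$ on $E_\sigma$ with $F_i\circ j_{s_i,\sigma}=f_i$, $\|F_i\|\le\lambda(1+\eta)$ and $F_i(j_{s_l,\sigma}(v_l))=\delta_{il}$. 3. $\|j_{s_1,\sigma}(v_1)+j_{s_2,\sigma}(v_2)\|\ge 2/\lambda>\lambda$. Hence $\|\sum_{i=1}^2a_i\,j_{s_i,\sigma}(v_i)\|\le\lambda\max_i|a_i|$ does not hold for all scalars $a_1,a_2$. 4. If moreover $d_{\gamma_2}$ is a multiple of $d_{\gamma_1}$ (for example if $X=\mathbb R$), then $n_\sigma=4$, $S_\sigma\subsetneq\ell_\infty^4$ is not a coordinate subspace, it contains $\operatorname{span}\{e_1+e_2,e_3+e_4\}$,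 and $\operatorname{span}\{j_{s_1,\sigma}(v_1),j_{s_2,\sigma}(v_2)\}=\{[(x,0)]:x\in\operatorname{span}\{e_1+e_2,e_3+e_4\}\}$. -/

import Mathlib

open Finset

universe u v

/-- The pushout relation `N = {(ξ, -ν ξ) : ξ ∈ S}` inside the `ℓ₁`-sum `ℓ_∞^n ⊕₁ E`
(`Fin n → ℝ` carries the sup norm). -/
def pushoutRel {n : ℕ} {E : Type v} [NormedAddCommGroup E] [NormedSpace ℝ E]
    (S : Submodule ℝ (Fin n → ℝ)) (ν : S →ₗ[ℝ] E) :
    Submodule ℝ (WithLp 1 ((Fin n → ℝ) × E)) :=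
  LinearMap.range
    ((WithLp.linearEquiv 1 ℝ ((Fin n → ℝ) × E)).symm.toLinearMap ∘ₗ S.subtype.prod (-ν))

/-- The Kisliakov pushout `(ℓ_∞^n ⊕₁ E) / N`, with its quotient norm. -/
abbrev KisliakovPushout {n : ℕ} {E : Type v} [NormedAddCommGroup E] [NormedSpace ℝ E]
    (S : Submodule ℝ (Fin n → ℝ)) (ν : S →ₗ[ℝ] E) : Type v :=
  WithLp 1 ((Fin n → ℝ) × E) ⧸ pushoutRel S ν

/-- The class `[(b, e)]` in the pushout. -/
def KisliakovPushout.cls {n : ℕ} {E : Type v} [NormedAddCommGroup E] [NormedSpace ℝ E]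
    (S : Submodule ℝ (Fin n → ℝ)) (ν : S →ₗ[ℝ] E) (b : Fin n → ℝ) (e : E) :
    KisliakovPushout S ν :=
  (pushoutRel S ν).mkQ (WithLp.toLp 1 (b, e))

/-- The anti-lexicographic (= colexicographic) order `u ⪯ t` on finite sets. -/
def antilexLE {ι : Type u} [LinearOrder ι] (u t : Finset ι) : Prop :=
  toColex u ≤ toColex t

/-- The immediate anti-lexicographic predecessor of `t` among the subsets of `s`
(and `∅` if there is none). -/
def antilexPred {ι : Type u} [LinearOrder ι] (s t : Finset ι) : Finset ι :=
  ofColex ((s.powerset.filter fun u => toColex u < toColex t).sup toColex)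

/-- `antilexPred s t` is the greatest subset of `s` strictly below `t`. -/
theorem antilexPred_spec {ι : Type u} [LinearOrder ι] {s t : Finset ι} (ht : t.Nonempty) :
    antilexPred s t ⊆ s ∧ toColex (antilexPred s t) < toColex t ∧
      ∀ w, w ⊆ s → toColex w < toColex t → antilexLE w (antilexPred s t) := by
  have hne : (s.powerset.filter fun u => toColex u < toColex t).Nonempty := by
    refine ⟨∅, ?_⟩
    simp only [mem_filter, mem_powerset, empty_subset, true_and]
    exact Finset.Colex.toColex_lt_toColex_of_ssubset ht.empty_ssubset
  obtain ⟨w, hw, hwe⟩ := Finset.exists_mem_eq_sup _ hne (toColex : Finset ι → Colex (Finset ι))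
  have hp : antilexPred s t = w := by
    unfold antilexPred
    rw [hwe]
    rfl
  rw [hp]
  simp only [mem_filter, mem_powerset] at hw
  refine ⟨hw.1, hw.2, fun x hx hxt => ?_⟩
  unfold antilexLE
  rw [← hwe]
  exact Finset.le_sup (f := (toColex : Finset ι → Colex (Finset ι))) (by simp [hx, hxt])

/-- The raw data of a Lopez-Abad system over `X`: the integers `n t`, the subspaces
`S t ⊆ ℓ_∞^{n t}`, the local spaces `E s t` (that is `E_t^{(s)}`, for `t ⊆ s`), the
identification `E_∅^{(s)} = X`, the maps
`ν s t : S_t → E^{(s)}` into the stage before `t`,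
`i s t : x ↦ [(x, 0)]`, the local embeddings `j s u t : E_u^{(s)} → E_t^{(s)}` and the
transition maps `k t s u : E_u^{(t)} → E_u^{(s)}`.  Only the values with
`u ⪯ t` and `u, t ⊆ s` (for `j`) and `u ⊆ t ⊆ s` (for `k`) are meaningful; which maps these
are is fixed by `LopezAbadData.IsRealization`. -/
structure LopezAbadData (ι : Type u) [LinearOrder ι] (X : Type v)
    [NormedAddCommGroup X] [NormedSpace ℝ X] where
  n : Finset ι → ℕ
  S : ∀ t : Finset ι, Submodule ℝ (Fin (n t) → ℝ)
  E : Finset ι → Finset ι → Type (max u v)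
  [instGroup : ∀ s t, NormedAddCommGroup (E s t)]
  [instSpace : ∀ s t, NormedSpace ℝ (E s t)]
  base : ∀ s, X ≃ₗᵢ[ℝ] E s ∅
  ν : ∀ s t : Finset ι, S t →ₗ[ℝ] E s (antilexPred s t)
  i : ∀ s t : Finset ι, (Fin (n t) → ℝ) →ₗ[ℝ] E s t
  j : ∀ s u t : Finset ι, E s u →ₗ[ℝ] E s t
  k : ∀ t s u : Finset ι, E t u →ₗ[ℝ] E s u

namespace LopezAbadData

attribute [instance] LopezAbadData.instGroup LopezAbadData.instSpace

variable {ι : Type u} [LinearOrder ι] {X : Type v} [NormedAddCommGroup X] [NormedSpace ℝ X]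

/-- The distinguished subspace `G_t^{(s)} = {[(x, 0)] : x ∈ ℓ_∞^{n_t}}` (for `t ≠ ∅`). -/
def G (R : LopezAbadData ι X) (s t : Finset ι) : Submodule ℝ (R.E s t) :=
  LinearMap.range (R.i s t)

/-- The accumulated subspace `Y_t` of the stage before `t` in the local system of `s`: the span
of the images of all `G_u`, `∅ ≠ u ⊊ t`, and of `X_t = span {d_α : α ∈ t}`. -/
def Y (R : LopezAbadData ι X) (d : ι → X) (s t : Finset ι) :
    Submodule ℝ (R.E s (antilexPred s t)) :=
  (⨆ u : {u : Finset ι // u.Nonempty ∧ u ⊂ t},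
      (R.G s u.1).map (R.j s u.1 (antilexPred s t))) ⊔
    (Submodule.span ℝ (d '' (t : Set ι))).map
      (R.j s ∅ (antilexPred s t) ∘ₗ (R.base s).toLinearEquiv.toLinearMap)

/-- The global map `j_{t,s} = j_{t,s}^{(s)} ∘ k_t^{(t,s)} : E_t → E_s`, where
`E_t = E_t^{(t)}`. -/
def glob (R : LopezAbadData ι X) (t s : Finset ι) : R.E t t →ₗ[ℝ] R.E s s :=
  R.j s t s ∘ₗ R.k t s t

/-- `R` is a general (valid) realization of the Lopez-Abad construction over the family `d`
with constants `lam`, `eta`. -/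
structure IsRealization (R : LopezAbadData ι X) (d : ι → X) (lam eta : ℝ) : Prop where
  /-- `S_t` is a proper subspace of `ℓ_∞^{n_t}`. -/
  proper : ∀ t : Finset ι, t.Nonempty → R.S t ≠ ⊤
  /-- `ν_t` maps `S_t` onto `Y_t`. -/
  ν_range : ∀ s t : Finset ι, t ⊆ s → t.Nonempty → LinearMap.range (R.ν s t) = R.Y d s t
  /-- `‖ν_t‖ ≤ η`. -/
  ν_le : ∀ s t : Finset ι, t ⊆ s → t.Nonempty → ∀ ξ : R.S t, ‖R.ν s t ξ‖ ≤ eta * ‖ξ‖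
  /-- `ν_t` is injective and `‖ν_t⁻¹‖ ≤ λ`. -/
  ν_ge : ∀ s t : Finset ι, t ⊆ s → t.Nonempty → ∀ ξ : R.S t, ‖ξ‖ ≤ lam * ‖R.ν s t ξ‖
  /-- `E_t^{(s)}` is the pushout of `ℓ_∞^{n_t}` and the preceding space along `ν_t`, with its
  canonical maps `x ↦ [(x, 0)]` and `e ↦ [(0, e)]`. -/
  pushout : ∀ s t : Finset ι, t ⊆ s → t.Nonempty →
    ∃ g : KisliakovPushout (R.S t) (R.ν s t) ≃ₗᵢ[ℝ] R.E s t,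
      (∀ x, g (KisliakovPushout.cls _ _ x 0) = R.i s t x) ∧
      ∀ e, g (KisliakovPushout.cls _ _ 0 e) = R.j s (antilexPred s t) t e
  /-- Each local system is a chain of isometric embeddings. -/
  j_refl : ∀ s t : Finset ι, t ⊆ s → R.j s t t = LinearMap.id
  j_comp : ∀ s u t w : Finset ι, u ⊆ s → t ⊆ s → w ⊆ s → antilexLE u t → antilexLE t w →
    R.j s t w ∘ₗ R.j s u t = R.j s u w
  j_isometry : ∀ s u t : Finset ι, u ⊆ s → t ⊆ s → antilexLE u t → Isometry (R.j s u t)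
  /-- The transition maps are isometric, fix `X`, preserve the `ℓ_∞^{n_u}` component and commute
  with the local embeddings. -/
  k_isometry : ∀ u t s : Finset ι, u ⊆ t → t ⊆ s → Isometry (R.k t s u)
  k_base : ∀ t s : Finset ι, t ⊆ s → ∀ x : X, R.k t s ∅ (R.base t x) = R.base s x
  k_i : ∀ u t s : Finset ι, u.Nonempty → u ⊆ t → t ⊆ s →
    ∀ x, R.k t s u (R.i t u x) = R.i s u x
  k_j : ∀ u w t s : Finset ι, u ⊆ t → w ⊆ t → t ⊆ s → antilexLE u w →
    R.k t s w ∘ₗ R.j t u w = R.j s u w ∘ₗ R.k t s u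

end LopezAbadData

/-- A coordinate subspace of `ℓ_∞^n`: the span of a set of standard basis vectors. -/
def IsCoordinateSubspace {n : ℕ} (S : Submodule ℝ (Fin n → ℝ)) : Prop :=
  ∃ I : Set (Fin n), S = Submodule.span ℝ ((fun l => Pi.single l (1 : ℝ)) '' I)

/-- The standard basis vector of `ℓ_∞^n` with (zero-based) index `l : Fin m`, when `n = m`. -/
def stdVec {n m : ℕ} (h : n = m) (l : Fin m) : Fin n → ℝ :=
  Pi.single (Fin.cast h.symm l) 1

/-! The upper bound fails because `S_{s_i}` is the diagonal of `ℓ_∞²`. The functional `h_i = (b₁ -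
b₂)/2` on the `i`-th copy of `ℓ_∞²` vanishes on the diagonal, hence on every relation imposed at the
two singletons. In an `ℓ₁`-sum `h₁ + h₂` is still contractive, and it takes the value 2 at `v₁ +
v₂`. So the norm of the sum is at least 2, which is at least `2/λ`, and `2/λ > λ` since `λ² < 2`.

The main work is to produce a whole realization with these prescribed stages. Everything is placed
in one space: take the `ℓ₁`-sum (`Ambient`) of `X` and the blocks `ℓ_∞^n`, choose for each `t` an
inverse `T_t` of `ν_t`, and divide by the closure of all relations `[(T_t y, 0)] = [(0, y)]`, with
`y` in the lift of `Y_t`. The local spaces become subspaces of the quotient `Z`, generated by `X`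
and the blocks up to `t`, and all maps `j`, `k` become inclusions, so coherence is automatic
(`isRealization_ofMaps`).

What has to be proved is that `Z` induces the pushout norms. This is a locality principle,
`norm_mkQ_relOn_eq`: since `η < 1` makes the `T_t` expanding, relations outside a family of sets
closed under subsets do not change the norm of vectors supported in that family. The order `≺`
enters only through the fact that it extends inclusion.

The maps `T_t` are chosen by recursion along inclusion (`exists_forall_isGood`): norming functionals
at the singletons (`exists_isSingle`), a multiple of an isometric embedding of `ℓ₁³` into `ℓ_∞⁴` at
the pair in the proportional case (`exists_isPair`), and a scaled almost isometric embedding of a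
finite-dimensional space elsewhere (`exists_isAdmissible`). -/

set_option linter.unusedSectionVars false

/-! ### Quotient seminorms by subspaces that need not be closed. -/

section Quotient

variable {V : Type*} [SeminormedAddCommGroup V] [NormedSpace ℝ V]

theorem Submodule.norm_mkQ_le_norm_add (N : Submodule ℝ V) (x : V) {w : V} (hw : w ∈ N) :
    ‖N.mkQ x‖ ≤ ‖x + w‖ := by
  have : N.mkQ x = N.mkQ (x + w) := by
    rw [map_add, left_eq_add]
    exact (Submodule.Quotient.mk_eq_zero N).2 hw
  rw [this]
  exact Submodule.Quotient.norm_mk_le N _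

theorem Submodule.norm_mkQ_le (N : Submodule ℝ V) (x : V) : ‖N.mkQ x‖ ≤ ‖x‖ :=
  Submodule.Quotient.norm_mk_le N _

theorem Submodule.exists_norm_add_lt (N : Submodule ℝ V) {x : V} {δ : ℝ} (h : ‖N.mkQ x‖ < δ) :
    ∃ w ∈ N, ‖x + w‖ < δ := by
  obtain ⟨m, hm, hlt⟩ := Submodule.Quotient.norm_mk_lt (N.mkQ x) (sub_pos.2 h)
  refine ⟨m - x, ?_, by simpa using hlt⟩
  exact (Submodule.Quotient.eq N).1 hm

theorem Submodule.norm_mkQ_mono {N M : Submodule ℝ V} (h : N ≤ M) (x : V) :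
    ‖M.mkQ x‖ ≤ ‖N.mkQ x‖ := by
  refine le_of_forall_gt fun δ hδ => ?_
  obtain ⟨w, hw, hlt⟩ := N.exists_norm_add_lt hδ
  exact (M.norm_mkQ_le_norm_add x (h hw)).trans_lt hlt

/-- The algebraic span of the relations is convenient for computing; its closure is needed to get a
genuine norm. This lemma allows switching between the two. -/
theorem Submodule.norm_mkQ_topologicalClosure (N : Submodule ℝ V) (x : V) :
    ‖N.topologicalClosure.mkQ x‖ = ‖N.mkQ x‖ := by
  refine le_antisymm (Submodule.norm_mkQ_mono N.le_topologicalClosure x) ?_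
  refine le_of_forall_gt fun δ hδ => ?_
  obtain ⟨w, hw, hlt⟩ := N.topologicalClosure.exists_norm_add_lt hδ
  obtain ⟨w', hw', hd⟩ := Metric.mem_closure_iff.1 hw (δ - ‖x + w‖) (sub_pos.2 hlt)
  refine (N.norm_mkQ_le_norm_add x hw').trans_lt ?_
  have h1 : x + w' = (x + w) - (w - w') := by abel
  rw [dist_eq_norm] at hd
  rw [h1]
  linarith [norm_sub_le (x + w) (w - w')]

theorem Submodule.norm_mkQ_bot (x : V) : ‖(⊥ : Submodule ℝ V).mkQ x‖ = ‖x‖ := by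
  refine le_antisymm (Submodule.norm_mkQ_le _ _) (le_of_forall_gt fun δ hδ => ?_)
  obtain ⟨w, hw, h⟩ := Submodule.exists_norm_add_lt _ hδ
  rwa [(Submodule.mem_bot ℝ).1 hw, add_zero] at h

end Quotient

/-! ### The ambient `ℓ₁`-sum. -/

noncomputable section

/-- The ambient `ℓ₁`-sum of `X` and of all the spaces `ℓ_∞^n`, one for every finite set and every
dimension. -/
abbrev Ambient (ι : Type u) (X : Type v) [NormedAddCommGroup X] : Type (max u v) :=
  -- Indexing by pairs `(t, n)` makes the space independent of the dimensions `n_t`, which are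
  -- chosen only later by recursion.
  WithLp 1 (X × lp (fun q : Finset ι × ℕ => Fin q.2 → ℝ) 1)

namespace Ambient

variable {ι : Type u} [LinearOrder ι] {X : Type v} [NormedAddCommGroup X] [NormedSpace ℝ X]

variable (ι) in
/-- The inclusion of `X`. -/
def inX : X →ₗ[ℝ] Ambient ι X :=
  (WithLp.linearEquiv 1 ℝ _).symm.toLinearMap ∘ₗ LinearMap.inl ℝ X _

variable (X) in
/-- The inclusion of the summand `ℓ_∞^n` attached to `t`. -/
def inc (t : Finset ι) (n : ℕ) : (Fin n → ℝ) →ₗ[ℝ] Ambient ι X :=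
  (WithLp.linearEquiv 1 ℝ _).symm.toLinearMap ∘ₗ LinearMap.inr ℝ X _ ∘ₗ
    lp.lsingle (E := fun q : Finset ι × ℕ => Fin q.2 → ℝ) (𝕜 := ℝ) 1 (t, n)

/-- The projection to the summand `ℓ_∞^n` attached to `t`. -/
def coord (t : Finset ι) (n : ℕ) : Ambient ι X →ₗ[ℝ] (Fin n → ℝ) :=
  lp.evalₗ (𝕜 := ℝ) (fun q : Finset ι × ℕ => Fin q.2 → ℝ) 1 (t, n) ∘ₗ LinearMap.snd ℝ X _ ∘ₗ
    (WithLp.linearEquiv 1 ℝ _).toLinearMap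

/-- The projection to `X`. -/
def toX : Ambient ι X →ₗ[ℝ] X :=
  LinearMap.fst ℝ X _ ∘ₗ (WithLp.linearEquiv 1 ℝ _).toLinearMap

@[simp] theorem toX_inX (x : X) : toX (inX ι x) = x := rfl

@[simp] theorem toX_inc (t : Finset ι) (n : ℕ) (b : Fin n → ℝ) : toX (inc X t n b) = 0 := rfl

@[simp] theorem coord_inX (t : Finset ι) (n : ℕ) (x : X) : coord t n (inX ι x) = 0 := rfl

@[simp] theorem coord_inc_self (t : Finset ι) (n : ℕ) (b : Fin n → ℝ) :
    coord t n (inc X t n b) = b :=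
  lp.single_apply_self (E := fun q : Finset ι × ℕ => Fin q.2 → ℝ) 1 (t, n) b

theorem coord_inc_of_ne {t u : Finset ι} (h : t ≠ u) (n m : ℕ) (b : Fin m → ℝ) :
    coord t n (inc X u m b) = 0 :=
  lp.single_apply_ne (E := fun q : Finset ι × ℕ => Fin q.2 → ℝ) 1 (u, m) b
    (j := (t, n)) (fun e => h (congrArg Prod.fst e))

theorem norm_eq_toX_add (z : Ambient ι X) : ‖z‖ = ‖toX z‖ + ‖z.snd‖ :=
  WithLp.prod_norm_eq_of_L1 z

@[simp] theorem norm_inX (x : X) : ‖inX ι x‖ = ‖x‖ := by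
  rw [norm_eq_toX_add, toX_inX]
  have : (inX ι x).snd = 0 := rfl
  simp [this]

@[simp] theorem norm_inc (t : Finset ι) (n : ℕ) (b : Fin n → ℝ) : ‖inc X t n b‖ = ‖b‖ := by
  rw [norm_eq_toX_add, toX_inc, norm_zero, zero_add]
  exact lp.norm_single (E := fun q : Finset ι × ℕ => Fin q.2 → ℝ) one_pos (t, n) b

theorem norm_inc_add (t : Finset ι) (n : ℕ) (b : Fin n → ℝ) {z : Ambient ι X}
    (hz : coord t n z = 0) : ‖inc X t n b + z‖ = ‖b‖ + ‖z‖ := by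
  rw [norm_eq_toX_add, norm_eq_toX_add z, map_add, toX_inc, zero_add]
  have h := lp.norm_sub_norm_compl_sub_single (p := 1) (by simp)
    ((inc X t n b + z).snd) {(t, n)}
  rw [sum_singleton, sum_singleton] at h
  have h1 : (inc X t n b + z).snd (t, n) = b := by
    change coord t n (inc X t n b + z) = b
    rw [map_add, hz, coord_inc_self, add_zero]
  have h2 : (inc X t n b + z).snd - lp.single 1 (t, n) b = z.snd := by
    change (lp.single 1 (t, n) b + z.snd) - lp.single 1 (t, n) b = z.snd
    abel
  rw [h1, h2] at h
  simp only [ENNReal.toReal_one, Real.rpow_one] at h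
  linarith

theorem norm_toX_add_coord_le (z : Ambient ι X) (q : Finset (Finset ι × ℕ)) :
    ‖toX z‖ + ∑ a ∈ q, ‖coord a.1 a.2 z‖ ≤ ‖z‖ := by
  rw [norm_eq_toX_add]
  have h := lp.sum_rpow_le_norm_rpow (p := 1) (by simp) z.snd q
  simp only [ENNReal.toReal_one, Real.rpow_one] at h
  exact add_le_add le_rfl h

end Ambient

/-! ### Relations between the blocks, and locality of the quotient norm. -/

open Ambient

/-- The data attached to a finite set `t`: the dimension `n_t` and an extension of `ν_t⁻¹` to the
ambient space. -/
abbrev LocalData (ι : Type u) [LinearOrder ι] (X : Type v) [NormedAddCommGroup X]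
    [NormedSpace ℝ X] : Type (max u v) :=
  -- The map is defined on the whole ambient space, not only on the lift of `Y_t`, so that its type
  -- does not depend on earlier choices.
  Σ n : ℕ, Ambient ι X →ₗ[ℝ] (Fin n → ℝ)

namespace LocalData

variable {ι : Type u} [LinearOrder ι] {X : Type v} [NormedAddCommGroup X] [NormedSpace ℝ X]

/-- The lift of `Y_t` to the ambient space. -/
def pre (d : ι → X) (F : Finset ι → LocalData ι X) (t : Finset ι) : Submodule ℝ (Ambient ι X) :=
  (⨆ u : {u : Finset ι // u.Nonempty ∧ u ⊂ t}, LinearMap.range (inc X u.1 (F u.1).1)) ⊔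
    (Submodule.span ℝ (d '' (t : Set ι))).map (inX ι)

/-- The relations `[(T y, 0)] = [(0, y)]` imposed at `t`. -/
def rel (d : ι → X) (F : Finset ι → LocalData ι X) (t : Finset ι) : Submodule ℝ (Ambient ι X) :=
  (pre d F t).map (inc X t (F t).1 ∘ₗ (F t).2 - LinearMap.id)

/-- The relations imposed at the members of `A`. -/
def relOn (d : ι → X) (F : Finset ι → LocalData ι X) (A : Set (Finset ι)) :
    Submodule ℝ (Ambient ι X) :=
  ⨆ u ∈ A, rel d F u

variable {d : ι → X} {F F' : Finset ι → LocalData ι X} {A B : Set (Finset ι)}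

theorem relOn_mono (h : A ⊆ B) : relOn d F A ≤ relOn d F B :=
  biSup_mono fun _ hu => h hu

theorem relOn_insert (t : Finset ι) : relOn d F (insert t A) = rel d F t ⊔ relOn d F A :=
  iSup_insert

theorem pre_congr {t : Finset ι} (h : ∀ u, u ⊂ t → F u = F' u) : pre d F t = pre d F' t := by
  unfold pre
  congr 1
  exact iSup_congr fun u => by rw [h u.1 u.2.2]

theorem rel_congr {t : Finset ι} (h : ∀ u, u ⊆ t → F u = F' u) : rel d F t = rel d F' t := by
  unfold rel
  rw [pre_congr fun u hu => h u hu.subset, h t subset_rfl]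

theorem relOn_congr (h : ∀ t ∈ A, ∀ u, u ⊆ t → F u = F' u) : relOn d F A = relOn d F' A :=
  biSup_congr fun t ht => rel_congr (h t ht)

theorem inc_mem_pre {t u : Finset ι} (hu : u.Nonempty) (hut : u ⊂ t) (b : Fin (F u).1 → ℝ) :
    inc X u (F u).1 b ∈ pre d F t :=
  Submodule.mem_sup_left <|
    (le_iSup (fun u : {u : Finset ι // u.Nonempty ∧ u ⊂ t} =>
      LinearMap.range (inc X u.1 (F u.1).1)) ⟨u, hu, hut⟩) ⟨b, rfl⟩

theorem coord_eq_zero_of_mem_pre {t u : Finset ι} (h : ¬ u ⊂ t) (n : ℕ) {y : Ambient ι X}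
    (hy : y ∈ pre d F t) : coord u n y = 0 := by
  suffices pre d F t ≤ LinearMap.ker (coord u n) from this hy
  refine sup_le (iSup_le ?_) ?_
  · rintro ⟨w, hw, hwt⟩ _ ⟨b, rfl⟩
    exact coord_inc_of_ne (fun e => h (by rwa [e])) _ _ _
  · rintro _ ⟨x, -, rfl⟩
    exact coord_inX _ _ _

theorem coord_eq_zero_of_mem_relOn {u : Finset ι} (h : ∀ a ∈ A, ¬ u ⊆ a) (n : ℕ)
    {y : Ambient ι X} (hy : y ∈ relOn d F A) : coord u n y = 0 := by
  suffices relOn d F A ≤ LinearMap.ker (coord u n) from this hy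
  refine iSup₂_le fun a ha => ?_
  rintro _ ⟨y, hy, rfl⟩
  have hua := h a ha
  simp only [LinearMap.mem_ker, LinearMap.sub_apply, LinearMap.comp_apply, LinearMap.id_apply,
    map_sub, coord_eq_zero_of_mem_pre (fun h' => hua h'.subset) n hy,
    coord_inc_of_ne (fun e => hua e.le), sub_zero]

/-- No relation from `A` touches the block `u`, so in that block only the relation at `u`
contributes, and the `ℓ₁`-norm splits. This is the pushout norm before the infimum is taken. -/
theorem exists_norm_inc_add_eq {u : Finset ι} (hA : ∀ a ∈ A, ¬ u ⊆ a) (b : Fin (F u).1 → ℝ)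
    {z w : Ambient ι X} (hz : coord u (F u).1 z = 0) (hw : w ∈ relOn d F (insert u A)) :
    ∃ y ∈ pre d F u, ∃ w₀ ∈ relOn d F A,
      ‖inc X u (F u).1 b + z + w‖ = ‖b - (F u).2 y‖ + ‖z + y + w₀‖ := by
  rw [relOn_insert] at hw
  obtain ⟨_, ⟨y, hy, rfl⟩, w₀, hw₀, rfl⟩ := Submodule.mem_sup.1 hw
  refine ⟨-y, neg_mem hy, w₀, hw₀, ?_⟩
  rw [← norm_inc_add]
  · congr 1
    simp only [LinearMap.sub_apply, LinearMap.comp_apply, LinearMap.id_apply, map_neg, map_sub]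
    abel
  · rw [map_add, map_add, hz, map_neg, coord_eq_zero_of_mem_pre (ssubset_irrefl u) _ hy,
      coord_eq_zero_of_mem_relOn hA _ hw₀]
    simp

/-- The inverse maps `T_u` are expanding, i.e. the maps `ν_u` are contractive. -/
def Expanding (d : ι → X) (F : Finset ι → LocalData ι X) : Prop :=
  ∀ u, ∀ y ∈ pre d F u, ‖(relOn d F {w | w ⊂ u}).mkQ y‖ ≤ ‖(F u).2 y‖

/-- Using the relation at `u` to replace `z` by `z + y` costs `‖T_u y‖` in the block `u`. As `T_u`
is expanding, this is at least the quotient norm of `y`, so by the triangle inequality nothing is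
gained. -/
theorem norm_mkQ_relOn_le_insert (hF : Expanding d F) {u : Finset ι} (hA : ∀ a ∈ A, ¬ u ⊆ a)
    (hu : {w | w ⊂ u} ⊆ A) {z : Ambient ι X} (hz : coord u (F u).1 z = 0) :
    ‖(relOn d F A).mkQ z‖ ≤ ‖(relOn d F (insert u A)).mkQ z‖ := by
  refine le_of_forall_gt fun δ hδ => ?_
  obtain ⟨w, hw, hlt⟩ := Submodule.exists_norm_add_lt _ hδ
  obtain ⟨y, hy, w₀, hw₀, h⟩ := exists_norm_inc_add_eq hA 0 hz hw
  rw [map_zero, zero_add, zero_sub, norm_neg] at h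
  refine lt_of_le_of_lt ?_ (h ▸ hlt)
  have h1 := hF u y hy
  have h2 := Submodule.norm_mkQ_mono (relOn_mono (d := d) (F := F) hu) y
  have h3 := (relOn d F A).norm_mkQ_le_norm_add (z + y) hw₀
  have h4 := norm_sub_le ((relOn d F A).mkQ (z + y)) ((relOn d F A).mkQ y)
  rw [← map_sub, add_sub_cancel_right] at h4
  linarith

theorem norm_mkQ_relOn_le_union (hF : Expanding d F) (hA : IsLowerSet A) {z : Ambient ι X}
    (hz : ∀ u ∉ A, ∀ n, coord u n z = 0) (B : Finset (Finset ι))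
    (hB : IsLowerSet (A ∪ (B : Set (Finset ι)))) :
    ‖(relOn d F A).mkQ z‖ ≤ ‖(relOn d F (A ∪ (B : Set (Finset ι)))).mkQ z‖ := by
  classical
  induction hk : B.card using Nat.strong_induction_on generalizing B with
  | _ k ih =>
    by_cases hne : ∃ u ∈ B, u ∉ A
    -- The new sets are removed one at a time, always an inclusion-maximal one: then it lies in no
    -- remaining set, and the remaining family is still closed under subsets.
    · obtain ⟨u, hu⟩ := (B.filter (· ∉ A)).exists_maximal (by
        obtain ⟨u, h1, h2⟩ := hne
        exact ⟨u, by simp [h1, h2]⟩)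
      have huB : u ∈ B ∧ u ∉ A := by simpa using hu.prop
      have hmax : ∀ a ∈ A ∪ ((B.erase u : Finset _) : Set (Finset ι)), ¬ u ⊆ a := by
        rintro a (ha | ha) hua
        · exact huB.2 (hA hua ha)
        · rw [mem_coe, mem_erase] at ha
          by_cases haA : a ∈ A
          · exact huB.2 (hA hua haA)
          · exact ha.1 (subset_antisymm
              (hu.le_of_ge (by simpa using ⟨ha.2, haA⟩) hua) hua)
      have hlow : IsLowerSet (A ∪ ((B.erase u : Finset _) : Set (Finset ι))) := by
        intro a b hba ha
        have hb : b ∈ A ∪ (B : Set (Finset ι)) :=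
          hB hba (ha.imp id fun h => by simpa using (mem_erase.1 h).2)
        refine hb.imp id fun h => ?_
        rw [mem_coe, mem_erase]
        refine ⟨?_, by simpa using h⟩
        rintro rfl
        exact hmax a ha hba
      have hins : A ∪ (B : Set (Finset ι)) =
          insert u (A ∪ ((B.erase u : Finset _) : Set (Finset ι))) := by
        rw [← Set.union_insert, ← coe_insert, insert_erase huB.1]
      refine (ih _ ?_ (B.erase u) hlow rfl).trans ?_
      · rw [← hk]
        exact card_erase_lt_of_mem huB.1
      · rw [hins]
        refine norm_mkQ_relOn_le_insert hF hmax ?_ (hz u huB.2 _)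
        intro w hw
        have : w ∈ A ∪ (B : Set (Finset ι)) := hB (le_of_lt hw) (Or.inr (by simpa using huB.1))
        refine this.imp id fun h => ?_
        rw [mem_coe, mem_erase]
        exact ⟨hw.ne, by simpa using h⟩
    · push Not at hne
      have : A ∪ (B : Set (Finset ι)) = A :=
        Set.union_eq_left.2 fun u hu => hne u (by simpa using hu)
      rw [this]

/-- On vectors supported in a lower set `A`, the relations outside `A` do not change the norm. -/
theorem norm_mkQ_relOn_eq (hF : Expanding d F) (hA : IsLowerSet A) {z : Ambient ι X}
    (hz : ∀ u ∉ A, ∀ n, coord u n z = 0) :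
    ‖(relOn d F A).mkQ z‖ = ‖(relOn d F Set.univ).mkQ z‖ := by
  refine le_antisymm ?_ (Submodule.norm_mkQ_mono (relOn_mono (Set.subset_univ _)) z)
  refine le_of_forall_gt fun δ hδ => ?_
  obtain ⟨w, hw, hlt⟩ := Submodule.exists_norm_add_lt _ hδ
  obtain ⟨B, hB⟩ : ∃ B : Finset (Finset ι), w ∈ relOn d F (B : Set (Finset ι)) := by
    unfold relOn at hw
    simp only [Set.mem_univ, iSup_pos] at hw
    obtain ⟨B, hB⟩ := Submodule.mem_iSup_iff_exists_finset.1 hw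
    exact ⟨B, by simpa [relOn] using hB⟩
  -- An element of the span uses finitely many relations; adding all subsets of their index sets
  -- gives a family that is still finite and closed under subsets.
  set B' : Finset (Finset ι) := B.biUnion powerset with hB'
  have hlow : IsLowerSet (B' : Set (Finset ι)) := by
    intro a b hba ha
    rw [mem_coe, hB', mem_biUnion] at ha ⊢
    obtain ⟨c, hc, hac⟩ := ha
    exact ⟨c, hc, mem_powerset.2 (hba.trans (mem_powerset.1 hac))⟩
  have hsub : (B : Set (Finset ι)) ⊆ A ∪ (B' : Set (Finset ι)) := fun c hc =>
    Or.inr (by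
      rw [mem_coe, hB', mem_biUnion]
      exact ⟨c, by simpa using hc, mem_powerset.2 subset_rfl⟩)
  refine (norm_mkQ_relOn_le_union hF hA hz B' (hA.union hlow)).trans_lt ?_
  exact (Submodule.norm_mkQ_le_norm_add _ z (relOn_mono hsub hB)).trans_lt hlt

end LocalData

end

/-! ### Recursive choice with local conditions. -/

/-- Construction of a function by well-founded recursion, each value being chosen so as to satisfy
a condition that depends on the values at smaller arguments only. -/
theorem exists_forall_of_local {α : Type*} {β : Type*} [PartialOrder α] [WellFoundedLT α]
    [DecidableEq α] [Nonempty β] (P : α → (α → β) → Prop)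
    (hcongr : ∀ t F F', (∀ u ≤ t, F u = F' u) → P t F → P t F')
    (hstep : ∀ t F, (∀ u < t, P u F) → ∃ x, P t (Function.update F t x)) :
    ∃ F : α → β, ∀ t, P t F := by
  classical
  let ext : ∀ t : α, (∀ u, u < t → β) → α → β := fun t G u =>
    if h : u < t then G u h else Classical.arbitrary β
  let step : ∀ t : α, (∀ u, u < t → β) → β := fun t G =>
    if h : ∃ x, P t (Function.update (ext t G) t x) then h.choose else Classical.arbitrary β
  let F : α → β := wellFounded_lt.fix step
  have hF : ∀ t, F t = step t fun u _ => F u := fun t => WellFounded.fix_eq _ _ _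
  refine ⟨F, fun t => ?_⟩
  induction t using WellFoundedLT.induction with
  | ind t ih =>
    have hext : ∀ u < t, ext t (fun u _ => F u) u = F u := fun u hu => by simp [ext, hu]
    have hex : ∃ x, P t (Function.update (ext t fun u _ => F u) t x) :=
      hstep t _ fun u hu =>
        hcongr u F _ (fun w hw => (hext w (hw.trans_lt hu)).symm) (ih u hu)
    refine hcongr t _ F (fun u hu => ?_) hex.choose_spec
    rcases hu.eq_or_lt with rfl | hlt
    · rw [Function.update_self, hF u]
      simp only [step, dif_pos hex]
    · rw [Function.update_of_ne hlt.ne, hext u hlt]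

/-! ### Almost isometric embeddings into `ℓ_∞^n`. -/

section Norming

/-- A finite-dimensional subspace is almost isometrically embedded into some `ℓ_∞^n`, with one
coordinate to spare, by an operator that is contractive on the whole space. -/
theorem exists_almost_norming {E : Type*} [NormedAddCommGroup E] [NormedSpace ℝ E]
    (Y : Submodule ℝ E) [FiniteDimensional ℝ Y] {κ : ℝ} (hκ : κ < 1) :
    ∃ (n : ℕ) (T : E →ₗ[ℝ] (Fin (n + 1) → ℝ)), (∀ x, ‖T x‖ ≤ ‖x‖) ∧ (∀ x, T x 0 = 0) ∧
      ∀ y ∈ Y, κ * ‖y‖ ≤ ‖T y‖ := by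
  -- A functional norming a point of this `(1 - κ)`-net takes a value above `κ` at every unit vector
  -- within distance `1 - κ` of that point.
  obtain ⟨s, hss, hsf, hs⟩ := (isCompact_sphere (0 : Y) 1).finite_cover_balls (sub_pos.2 hκ)
  obtain ⟨n, ⟨φ⟩⟩ := finite_iff_exists_equiv_fin.1 hsf.to_subtype
  let e : Fin n → Y := fun i => (φ.symm i : Y)
  choose g hg hge using fun y : Y => exists_dual_vector'' ℝ (y : E)
  let T : E →ₗ[ℝ] (Fin (n + 1) → ℝ) :=
    LinearMap.pi (Fin.cons 0 fun i => (g (e i)).toLinearMap)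
  have hT0 : ∀ x, T x 0 = 0 := fun x => rfl
  have hTs : ∀ x i, T x (Fin.succ i) = g (e i) x := fun x i => rfl
  have hgn : ∀ (y : Y) x, |g y x| ≤ ‖x‖ := fun y x =>
    ((g y).le_of_opNorm_le (hg y) x).trans_eq (one_mul _)
  refine ⟨n, T, fun x => ?_, hT0, fun y hy => ?_⟩
  · refine (pi_norm_le_iff_of_nonneg (norm_nonneg _)).2 fun i => ?_
    refine Fin.cases ?_ (fun i => ?_) i
    · simp [hT0]
    · rw [hTs]
      exact hgn _ _
  · by_cases h0 : y = 0
    · simp [h0]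
    have hpos : 0 < ‖y‖ := norm_pos_iff.2 h0
    set z : Y := ‖y‖⁻¹ • ⟨y, hy⟩ with hz
    have hzn : ‖z‖ = 1 := by
      rw [hz, norm_smul, norm_inv, norm_norm, Submodule.coe_norm]
      exact inv_mul_cancel₀ hpos.ne'
    have hzs := hs (mem_sphere_zero_iff_norm.2 hzn)
    simp only [Set.mem_iUnion, Metric.mem_ball, exists_prop] at hzs
    obtain ⟨w, hw, hd⟩ := hzs
    obtain ⟨i, rfl⟩ : ∃ i, e i = w := ⟨φ ⟨w, hw⟩, by simp [e]⟩
    have h1 : ‖((e i : Y) : E)‖ - g (e i) (z : E) ≤ ‖z - e i‖ := by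
      have h : g (e i) (e i : E) = ‖((e i : Y) : E)‖ := hge (e i)
      rw [← h, ← map_sub, norm_sub_rev, Submodule.coe_norm, Submodule.coe_sub]
      exact (le_abs_self _).trans (hgn _ _)
    have h2 : ‖((e i : Y) : E)‖ = 1 := mem_sphere_zero_iff_norm.1 (hss hw)
    have h3 : g (e i) (z : E) = ‖y‖⁻¹ * g (e i) y := by simp [hz]
    have h4 : κ ≤ g (e i) (z : E) := by
      rw [dist_eq_norm] at hd
      linarith
    rw [h3, le_inv_mul_iff₀ hpos, mul_comm] at h4
    refine (h4.trans (le_abs_self _)).trans ?_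
    rw [← hTs]
    exact norm_le_pi_norm (T y) _

end Norming

/-! ### Admissible choices: the generic stage, the singletons and the pair. -/

noncomputable section

open Ambient

namespace LocalData

variable {ι : Type u} [LinearOrder ι] {X : Type v} [NormedAddCommGroup X] [NormedSpace ℝ X]
variable {d : ι → X} {F F' : Finset ι → LocalData ι X} {A B : Set (Finset ι)}

/-- `D` is a valid choice at a stage with relations `N` and accumulated subspace `P`. -/
structure IsAdmissible (N P : Submodule ℝ (Ambient ι X)) (lam eta : ℝ) (D : LocalData ι X) :
    Prop where
  proper : P.map D.2 ≠ ⊤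
  le : ∀ y ∈ P, ‖N.mkQ y‖ ≤ eta * ‖D.2 y‖
  ge : ∀ y ∈ P, ‖D.2 y‖ ≤ lam * ‖N.mkQ y‖

instance finiteDimensional_pre (t : Finset ι) : FiniteDimensional ℝ (pre d F t) := by
  have : Finite {u : Finset ι // u.Nonempty ∧ u ⊂ t} :=
    Set.Finite.to_subtype ((t.powerset.finite_toSet).subset fun u hu => by
      simpa using hu.2.subset)
  have : FiniteDimensional ℝ (Submodule.span ℝ (d '' (t : Set ι))) :=
    FiniteDimensional.span_of_finite ℝ (t.finite_toSet.image d)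
  unfold pre
  infer_instance

/-- Take an embedding with lower constant `1/(λη) < 1` and multiply it by `λ`: the upper constant
becomes `λ` and the lower one `1/η`. The spare zero coordinate makes the image proper. -/
theorem exists_isAdmissible (N P : Submodule ℝ (Ambient ι X)) [FiniteDimensional ℝ P]
    {lam eta : ℝ} (hlam : 0 < lam) (hle : 1 < lam * eta) :
    ∃ D : LocalData ι X, IsAdmissible N P lam eta D := by
  have hcl : IsClosed (N.topologicalClosure : Set (Ambient ι X)) :=
    N.isClosed_topologicalClosure
  obtain ⟨n, T, hT, hT0, hTP⟩ := exists_almost_norming (P.map N.topologicalClosure.mkQ)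
    (inv_lt_one_of_one_lt₀ hle)
  refine ⟨⟨n + 1, lam • T ∘ₗ N.topologicalClosure.mkQ⟩, ?_, fun y hy => ?_, fun y hy => ?_⟩
  · intro h
    obtain ⟨y, -, hy⟩ : (Pi.single 0 1 : Fin (n + 1) → ℝ) ∈
        P.map (lam • T ∘ₗ N.topologicalClosure.mkQ) := h ▸ Submodule.mem_top
    have := congrFun hy 0
    simp [hT0] at this
  · have h := hTP _ (Submodule.mem_map_of_mem hy)
    rw [N.norm_mkQ_topologicalClosure, inv_mul_le_iff₀ (by linarith)] at h
    rw [LinearMap.smul_apply, norm_smul, Real.norm_of_nonneg hlam.le]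
    exact h.trans_eq (by simp only [LinearMap.comp_apply]; ring)
  · rw [LinearMap.smul_apply, norm_smul, Real.norm_of_nonneg hlam.le]
    gcongr
    exact (hT _).trans_eq (N.norm_mkQ_topologicalClosure y)

theorem pre_empty : pre d F ∅ = ⊥ := by
  rw [eq_bot_iff]
  refine sup_le (iSup_le ?_) ?_
  · rintro ⟨u, hu, hu'⟩
    exact absurd hu' (not_ssubset_empty u)
  · simp

theorem rel_empty : rel d F ∅ = ⊥ := by rw [rel, pre_empty, Submodule.map_bot]

theorem pre_singleton (a : ι) : pre d F {a} = Submodule.span ℝ {inX ι (d a)} := by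
  rw [pre, coe_singleton, Set.image_singleton, Submodule.map_span, Set.image_singleton,
    sup_eq_right]
  refine iSup_le ?_
  rintro ⟨u, hu, hu'⟩
  exact absurd (ssubset_singleton_iff.1 hu') hu.ne_empty

theorem relOn_ssubset_singleton (a : ι) : relOn d F {w | w ⊂ {a}} = ⊥ := by
  rw [eq_bot_iff]
  refine iSup₂_le fun u hu => ?_
  rw [ssubset_singleton_iff.1 hu, rel_empty]

/-- `D` describes the pushout of `ℓ_∞²` along `e₁ + e₂ ↦ d / (λ ‖d‖)`, where `g` norms `d`. -/
def IsSingle (g : StrongDual ℝ X) (lam : ℝ) (D : LocalData ι X) : Prop :=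
  D.1 = 2 ∧ ∀ y l, D.2 y l = lam * g (toX y)

/-- There are no nontrivial relations below a singleton, and `g` is isometric up to sign on the line
of `d a`, so `T` is exactly `λ` times an isometry there, with image in the diagonal. -/
theorem exists_isSingle (a : ι) (g : StrongDual ℝ X) (hga : g (d a) = ‖d a‖)
    {lam eta : ℝ} (hlam : 0 < lam) (hle : 1 < lam * eta) :
    ∃ D : LocalData ι X, IsSingle g lam D ∧
      IsAdmissible (relOn d F {w | w ⊂ {a}}) (pre d F {a}) lam eta D := by
  let T : Ambient ι X →ₗ[ℝ] (Fin 2 → ℝ) := LinearMap.pi fun _ => lam • g.toLinearMap ∘ₗ toX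
  have hT : ∀ y l, T y l = lam * g (toX y) := fun y l => rfl
  have hTn : ∀ c : ℝ, ‖T (c • inX ι (d a))‖ = lam * (|c| * ‖d a‖) := fun c => by
    have : T (c • inX ι (d a)) = fun _ => lam * (c * ‖d a‖) := by
      ext l
      rw [hT, map_smul, toX_inX, map_smul, hga, smul_eq_mul]
    rw [this, pi_norm_const, norm_mul, norm_mul, Real.norm_of_nonneg hlam.le, norm_norm]
    rfl
  refine ⟨⟨2, T⟩, ⟨rfl, hT⟩, ?_, ?_, ?_⟩
  · intro h
    obtain ⟨y, -, hy⟩ : (Pi.single 0 1 : Fin 2 → ℝ) ∈ (pre d F {a}).map T :=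
      h ▸ Submodule.mem_top
    have h0 := congrFun hy 0
    have h1 := congrFun hy 1
    rw [hT] at h0 h1
    rw [h0] at h1
    simp at h1
  all_goals
    intro y hy
    rw [pre_singleton] at hy
    obtain ⟨c, rfl⟩ := Submodule.mem_span_singleton.1 hy
    rw [relOn_ssubset_singleton, Submodule.norm_mkQ_bot, hTn, norm_smul, norm_inX, Real.norm_eq_abs]
  have : 0 ≤ |c| * ‖d a‖ := by positivity
  nlinarith

theorem IsSingle.inc_apply {g : StrongDual ℝ X} {lam : ℝ} {D : LocalData ι X}
    (h : IsSingle g lam D) (s : Finset ι) (y : Ambient ι X) :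
    inc X s D.1 (D.2 y) = inc X s 2 fun _ => lam * g (toX y) := by
  obtain ⟨n, T⟩ := D
  obtain ⟨hn, hT⟩ := h
  simp only at hn
  subst hn
  congr 1
  ext l
  exact hT y l

/-- `(b₁ - b₂) / 2`, where `b` is the component of a vector in `ℓ_∞²` at `s`. -/
def halfDiff (s : Finset ι) : Ambient ι X →ₗ[ℝ] ℝ :=
  (1 / 2 : ℝ) • (LinearMap.proj (R := ℝ) (φ := fun _ : Fin 2 => ℝ) 0 - LinearMap.proj 1) ∘ₗ coord s 2

/-- `(b₁ + b₂) / 2`, where `b` is the component of a vector in `ℓ_∞²` at `s`. -/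
def halfSum (s : Finset ι) : Ambient ι X →ₗ[ℝ] ℝ :=
  (1 / 2 : ℝ) • (LinearMap.proj (R := ℝ) (φ := fun _ : Fin 2 => ℝ) 0 + LinearMap.proj 1) ∘ₗ coord s 2

theorem halfDiff_apply (s : Finset ι) (z : Ambient ι X) :
    halfDiff s z = (coord s 2 z 0 - coord s 2 z 1) / 2 := by
  simp [halfDiff]; ring

theorem halfSum_apply (s : Finset ι) (z : Ambient ι X) :
    halfSum s z = (coord s 2 z 0 + coord s 2 z 1) / 2 := by
  simp [halfSum]; ring

/-- In these rotated coordinates `ℓ_∞²` is `ℓ₁²`: `max(|p|, |q|) = |p - q|/2 + |p + q|/2`. -/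
theorem abs_halfDiff_add_abs_halfSum_le (s : Finset ι) (z : Ambient ι X) :
    |halfDiff s z| + |halfSum s z| ≤ ‖coord s 2 z‖ := by
  rw [halfDiff_apply, halfSum_apply]
  have h0 := norm_le_pi_norm (coord s 2 z) 0
  have h1 := norm_le_pi_norm (coord s 2 z) 1
  rw [Real.norm_eq_abs, abs_le] at h0 h1
  rcases abs_cases ((coord s 2 z 0 - coord s 2 z 1) / 2) with h | h <;>
  rcases abs_cases ((coord s 2 z 0 + coord s 2 z 1) / 2) with h' | h' <;>
  rw [h.1, h'.1] <;> linarith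

theorem norm_toX_add_norm_coord_le {s t : Finset ι} (hst : s ≠ t) (z : Ambient ι X) :
    ‖toX z‖ + ‖coord s 2 z‖ + ‖coord t 2 z‖ ≤ ‖z‖ := by
  have h := norm_toX_add_coord_le z {(s, 2), (t, 2)}
  rwa [sum_pair (by simpa using hst), ← add_assoc] at h

/-- The functional on `E_σ` that takes the value `‖d₁‖` at `d₁` and vanishes on `e₁ - e₂`, in both
copies of `ℓ_∞²`. -/
def meanFunctional (s t : Finset ι) (g : StrongDual ℝ X) (lam ε : ℝ) : Ambient ι X →ₗ[ℝ] ℝ :=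
  g.toLinearMap ∘ₗ toX + lam⁻¹ • halfSum s + (lam⁻¹ * ε) • halfSum t

theorem meanFunctional_apply (s t : Finset ι) (g : StrongDual ℝ X) (lam ε : ℝ)
    (z : Ambient ι X) : meanFunctional s t g lam ε z =
      g (toX z) + lam⁻¹ * halfSum s z + lam⁻¹ * ε * halfSum t z := rfl

/-- `D` describes the isometric embedding (up to the factor `λ`) of `ℓ₁³` into `ℓ_∞⁴`. -/
def IsPair (s t : Finset ι) (g : StrongDual ℝ X) (lam ε : ℝ) (D : LocalData ι X) : Prop :=
  -- The four coordinates are the sign patterns `(+, ±, ±)`. Up to a global sign these are all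
  -- patterns on three coordinates, so their maximum modulus is the `ℓ₁³`-norm.
  D.1 = 4 ∧ ∀ y (l : Fin D.1), D.2 y l = lam * (halfDiff s y +
    (if (l : ℕ) < 2 then halfDiff t y else -halfDiff t y) +
    (if Even (l : ℕ) then meanFunctional s t g lam ε y else -meanFunctional s t g lam ε y))

theorem norm_apply_le_mul_norm_mkQ {V E : Type*} [SeminormedAddCommGroup V] [NormedSpace ℝ V]
    [SeminormedAddCommGroup E] [NormedSpace ℝ E] (N : Submodule ℝ V) (T : V →ₗ[ℝ] E) {C : ℝ}
    (hC : 0 < C) (hT : ∀ x, ‖T x‖ ≤ C * ‖x‖) (hN : ∀ w ∈ N, T w = 0) (x : V) :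
    ‖T x‖ ≤ C * ‖N.mkQ x‖ := by
  rw [← div_le_iff₀' hC]
  refine le_of_forall_gt fun δ hδ => ?_
  obtain ⟨w, hw, h⟩ := N.exists_norm_add_lt hδ
  have := hT (x + w)
  rw [map_add, hN w hw, add_zero] at this
  rw [div_lt_iff₀' hC]
  exact this.trans_lt (by gcongr)

theorem eq_of_ssubset_pair {a b : ι} {u : Finset ι} (hu : u.Nonempty) (h : u ⊂ {a, b}) :
    u = {a} ∨ u = {b} := by
  have hc : u.card < 2 := (card_lt_card h).trans_le card_le_two
  obtain ⟨c, rfl⟩ := card_eq_one.1 (le_antisymm (by omega) hu.card_pos)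
  have : c ∈ ({a, b} : Finset ι) := h.subset (mem_singleton_self c)
  rw [mem_insert, mem_singleton] at this
  exact this.imp (congrArg _) (congrArg _)

theorem singleton_ssubset_pair_left {a b : ι} (h : a ≠ b) : ({a} : Finset ι) ⊂ {a, b} := by
  refine (ssubset_iff_subset_ne).2 ⟨by simp, fun e => h ?_⟩
  have : b ∈ ({a} : Finset ι) := e ▸ (by simp)
  exact (mem_singleton.1 this).symm

theorem singleton_ssubset_pair_right {a b : ι} (h : a ≠ b) : ({b} : Finset ι) ⊂ {a, b} := by
  rw [pair_comm]
  exact singleton_ssubset_pair_left h.symm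

theorem mem_rel_singleton {a : ι} {g : StrongDual ℝ X} {lam : ℝ} (hF : IsSingle g lam (F {a}))
    {w : Ambient ι X} : w ∈ rel d F {a} ↔
      ∃ c : ℝ, w = inc X {a} 2 (fun _ => lam * (c * g (d a))) - inX ι (c • d a) := by
  rw [rel, pre_singleton]
  constructor
  · rintro ⟨y, hy, rfl⟩
    obtain ⟨c, rfl⟩ := Submodule.mem_span_singleton.1 hy
    refine ⟨c, ?_⟩
    rw [LinearMap.sub_apply, LinearMap.comp_apply, hF.inc_apply, LinearMap.id_apply, map_smul,
      map_smul, toX_inX, map_smul, smul_eq_mul]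
  · rintro ⟨c, rfl⟩
    refine ⟨c • inX ι (d a), Submodule.mem_span_singleton.2 ⟨c, rfl⟩, ?_⟩
    rw [LinearMap.sub_apply, LinearMap.comp_apply, hF.inc_apply, LinearMap.id_apply, map_smul,
      map_smul, toX_inX, map_smul, smul_eq_mul]

theorem apply_eq_zero_of_mem_relOn_pair {a b : ι} {E : Type*} [AddCommGroup E] [Module ℝ E]
    (T : Ambient ι X →ₗ[ℝ] E) (ha : ∀ w ∈ rel d F {a}, T w = 0) (hb : ∀ w ∈ rel d F {b}, T w = 0)
    (w : Ambient ι X) (hw : w ∈ relOn d F {u | u ⊂ {a, b}}) : T w = 0 := by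
  suffices relOn d F {u | u ⊂ {a, b}} ≤ LinearMap.ker T from this hw
  refine iSup₂_le fun u hu => ?_
  rcases u.eq_empty_or_nonempty with rfl | hne
  · rw [rel_empty]
    exact bot_le
  · rcases eq_of_ssubset_pair hne hu with rfl | rfl
    exacts [ha, hb]

@[simp] theorem halfDiff_inX (s : Finset ι) (x : X) : halfDiff s (inX ι x) = 0 := by
  simp [halfDiff_apply]

@[simp] theorem halfSum_inX (s : Finset ι) (x : X) : halfSum s (inX ι x) = 0 := by
  simp [halfSum_apply]

@[simp] theorem halfDiff_inc_self (s : Finset ι) (b : Fin 2 → ℝ) :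
    halfDiff s (inc X s 2 b) = (b 0 - b 1) / 2 := by
  simp [halfDiff_apply]

@[simp] theorem halfSum_inc_self (s : Finset ι) (b : Fin 2 → ℝ) :
    halfSum s (inc X s 2 b) = (b 0 + b 1) / 2 := by
  simp [halfSum_apply]

theorem halfDiff_inc_of_ne {s t : Finset ι} (h : s ≠ t) (n : ℕ) (b : Fin n → ℝ) :
    halfDiff s (inc X t n b) = 0 := by
  simp [halfDiff_apply, coord_inc_of_ne h]

theorem halfSum_inc_of_ne {s t : Finset ι} (h : s ≠ t) (n : ℕ) (b : Fin n → ℝ) :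
    halfSum s (inc X t n b) = 0 := by
  simp [halfSum_apply, coord_inc_of_ne h]

theorem halfDiff_eq_zero_of_mem_rel_singleton {a b : ι} {g : StrongDual ℝ X} {lam : ℝ}
    (hF : IsSingle g lam (F {a})) (w : Ambient ι X) (hw : w ∈ rel d F {a}) :
    halfDiff {b} w = 0 := by
  obtain ⟨c, rfl⟩ := (mem_rel_singleton hF).1 hw
  by_cases h : ({b} : Finset ι) = {a}
  · rw [h]
    simp
  · simp [halfDiff_inc_of_ne h]

theorem range_inc_congr (s : Finset ι) {n m : ℕ} (h : n = m) :
    LinearMap.range (inc X s n) = LinearMap.range (inc X s m) := by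
  rw [h]

theorem exists_eq_of_mem_pre_pair {a b : ι} (ha : (F {a}).1 = 2) (hb : (F {b}).1 = 2) {c : ℝ}
    (hc : d b = c • d a) {y : Ambient ι X} (hy : y ∈ pre d F {a, b}) :
    ∃ (p q : Fin 2 → ℝ) (r : ℝ), y = inc X {a} 2 p + inc X {b} 2 q + inX ι (r • d a) := by
  suffices pre d F {a, b} ≤ LinearMap.range (inc X {a} 2) ⊔ LinearMap.range (inc X {b} 2) ⊔
      (Submodule.span ℝ {d a}).map (inX ι) by
    obtain ⟨_, h, _, ⟨z, hz, rfl⟩, rfl⟩ := Submodule.mem_sup.1 (this hy)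
    obtain ⟨_, ⟨p, rfl⟩, _, ⟨q, rfl⟩, rfl⟩ := Submodule.mem_sup.1 h
    obtain ⟨r, rfl⟩ := Submodule.mem_span_singleton.1 hz
    exact ⟨p, q, r, rfl⟩
  refine sup_le_sup (iSup_le ?_) (Submodule.map_mono (Submodule.span_le.2 ?_))
  · rintro ⟨u, hu, hu'⟩
    rcases eq_of_ssubset_pair hu hu' with rfl | rfl
    · exact (range_inc_congr _ ha).le.trans le_sup_left
    · exact (range_inc_congr _ hb).le.trans le_sup_right
  · rintro _ ⟨e, he, rfl⟩
    rw [mem_coe, mem_insert, mem_singleton] at he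
    rcases he with rfl | rfl
    · exact Submodule.mem_span_singleton_self _
    · exact Submodule.mem_span_singleton.2 ⟨c, hc.symm⟩

theorem rel_le_relOn {t : Finset ι} (ht : t ∈ A) : rel d F t ≤ relOn d F A :=
  le_iSup₂ (f := fun u (_ : u ∈ A) => rel d F u) t ht

theorem norm_sub_mean_le (p : Fin 2 → ℝ) :
    ‖p - fun _ => (p 0 + p 1) / 2‖ ≤ |(p 0 - p 1) / 2| := by
  refine (pi_norm_le_iff_of_nonneg (abs_nonneg _)).2 (Fin.forall_fin_two.2 ⟨?_, ?_⟩)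
  · rw [Pi.sub_apply, Real.norm_eq_abs]
    exact le_of_eq (congrArg _ (by ring))
  · rw [Pi.sub_apply, Real.norm_eq_abs, ← abs_neg]
    exact le_of_eq (congrArg _ (by ring))

/-- Modulo the singleton relations, both diagonals fall into the line of `d a`. What remains is
generated by that line and the two vectors `e₁ - e₂`, and its quotient norm is exactly the `ℓ₁`-norm
of the coordinates `halfDiff {a}`, `halfDiff {b}` and `r`. Hence `T` is `λ` times an isometry on the
quotient. -/
theorem exists_isPair {a b : ι} (hab : a ≠ b) (ga gb : StrongDual ℝ X) (hga : ‖ga‖ ≤ 1)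
    (ha : ga (d a) = ‖d a‖) (hb : gb (d b) = ‖d b‖) (hda : d a ≠ 0) (hdb : d b ≠ 0)
    {c : ℝ} (hc : d b = c • d a)
    {lam eta : ℝ} (hlam : 1 < lam) (hle : 1 < lam * eta)
    (hFa : IsSingle ga lam (F {a})) (hFb : IsSingle gb lam (F {b})) :
    ∃ D : LocalData ι X, IsPair {a} {b} ga lam (ga (d b) / ‖d b‖) D ∧
      IsAdmissible (relOn d F {w | w ⊂ {a, b}}) (pre d F {a, b}) lam eta D := by
  have hst : ({a} : Finset ι) ≠ {b} := by simpa using hab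
  have hlam0 : 0 < lam := by linarith
  have hna : 0 < ‖d a‖ := norm_pos_iff.2 hda
  have hnb : 0 < ‖d b‖ := norm_pos_iff.2 hdb
  set ε : ℝ := ga (d b) / ‖d b‖ with hε
  have hgn : ∀ x, |ga x| ≤ ‖x‖ := fun x => (ga.le_of_opNorm_le hga x).trans_eq (one_mul _)
  have hε1 : |ε| ≤ 1 := by
    rw [hε, abs_div, abs_norm]
    exact div_le_one_of_le₀ (hgn _) (norm_nonneg _)
  set r := meanFunctional {a} {b} ga lam ε with hr
  let T : Ambient ι X →ₗ[ℝ] (Fin 4 → ℝ) := LinearMap.pi fun l =>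
    lam • (halfDiff {a} + (if (l : ℕ) < 2 then halfDiff {b} else -halfDiff {b}) +
      (if Even (l : ℕ) then r else -r))
  have hT : ∀ y (l : Fin 4), T y l = lam * (halfDiff {a} y +
      (if (l : ℕ) < 2 then halfDiff {b} y else -halfDiff {b} y) +
      (if Even (l : ℕ) then r y else -r y)) := fun y l => by
    simp only [T, LinearMap.pi_apply]
    split_ifs <;> simp <;> ring
  -- The coefficients of `r` have modulus at most 1, so each block contributes at most `|halfDiff| +
  -- |halfSum|`, that is, its sup norm.
  have hrle : ∀ y, |halfDiff {a} y| + |halfDiff {b} y| + |r y| ≤ ‖y‖ := fun y => by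
    have h1 := abs_halfDiff_add_abs_halfSum_le {a} y
    have h2 := abs_halfDiff_add_abs_halfSum_le {b} y
    have h3 := norm_toX_add_norm_coord_le hst y
    have h4 := hgn (toX y)
    have hl : lam⁻¹ ≤ 1 := (inv_lt_one_of_one_lt₀ hlam).le
    have hl0 : 0 < lam⁻¹ := inv_pos.2 hlam0
    have h5 : |lam⁻¹ * halfSum {a} y| ≤ |halfSum {a} y| := by
      rw [abs_mul, abs_of_pos hl0]
      exact mul_le_of_le_one_left (abs_nonneg _) hl
    have h6 : |lam⁻¹ * ε * halfSum {b} y| ≤ |halfSum {b} y| := by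
      rw [abs_mul, abs_mul, abs_of_pos hl0]
      exact mul_le_of_le_one_left (abs_nonneg _) (mul_le_one₀ hl (abs_nonneg _) hε1)
    have h7 : |r y| ≤ |ga (toX y)| + |lam⁻¹ * halfSum {a} y| + |lam⁻¹ * ε * halfSum {b} y| := by
      rw [hr, meanFunctional_apply]
      exact abs_add_three _ _ _
    linarith
  have hTle : ∀ y, ‖T y‖ ≤ lam * ‖y‖ := fun y => by
    refine (pi_norm_le_iff_of_nonneg (by positivity)).2 fun l => ?_
    rw [hT, norm_mul, Real.norm_of_nonneg hlam0.le]
    gcongr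
    refine le_trans (abs_add_three _ _ _) (le_trans (le_of_eq ?_) (hrle y))
    split_ifs <;> simp
  -- The relation identifies the diagonal vector of height `λ‖d a‖` with `d a`, which forces the
  -- coefficient `λ⁻¹` of `halfSum`. At `b`, the factor `ε` accounts for the sign of `d b` relative
  -- to `d a`.
  have hra : ∀ w ∈ rel d F {a}, r w = 0 := fun w hw => by
    obtain ⟨e, rfl⟩ := (mem_rel_singleton hFa).1 hw
    rw [hr, meanFunctional_apply]
    simp [halfSum_inc_of_ne hst.symm]
    field_simp
    ring
  have hrb : ∀ w ∈ rel d F {b}, r w = 0 := fun w hw => by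
    obtain ⟨e, rfl⟩ := (mem_rel_singleton hFb).1 hw
    rw [hr, meanFunctional_apply]
    simp [halfSum_inc_of_ne hst]
    rw [hb, hε]
    field_simp
    ring
  have hT0 : ∀ w ∈ relOn d F {w | w ⊂ {a, b}}, T w = 0 :=
    apply_eq_zero_of_mem_relOn_pair T
      (fun w hw => by
        ext l
        simp [hT, halfDiff_eq_zero_of_mem_rel_singleton hFa w hw, hra w hw])
      (fun w hw => by
        ext l
        simp [hT, halfDiff_eq_zero_of_mem_rel_singleton hFb w hw, hrb w hw])
  refine ⟨⟨4, T⟩, ⟨rfl, hT⟩, ?_, fun y hy => ?_, fun y _ =>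
    norm_apply_le_mul_norm_mkQ _ T hlam0 hTle hT0 y⟩
  · intro h
    obtain ⟨y, -, hy⟩ : (Pi.single 0 1 : Fin 4 → ℝ) ∈ (pre d F {a, b}).map T :=
      h ▸ Submodule.mem_top
    have h0 : T y 0 = 1 := congrFun hy 0
    have h1 : T y 1 = 0 := congrFun hy 1
    have h2 : T y 2 = 0 := congrFun hy 2
    have h3 : T y 3 = 0 := congrFun hy 3
    rw [hT, if_pos (by decide), if_pos (by decide)] at h0
    rw [hT, if_pos (by decide), if_neg (by decide)] at h1
    rw [hT, if_neg (by decide), if_pos (by decide)] at h2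
    rw [hT, if_neg (by decide), if_neg (by decide)] at h3
    -- The image lies in the hyperplane `x₀ - x₁ - x₂ + x₃ = 0`, which does not contain the first
    -- basis vector.
    linarith
  · have hmax : lam * (|halfDiff {a} y| + |halfDiff {b} y| + |r y|) ≤ ‖T y‖ := by
      obtain ⟨l, hl⟩ : ∃ l : Fin 4, |halfDiff {a} y| + |halfDiff {b} y| + |r y| ≤
          |halfDiff {a} y + (if (l : ℕ) < 2 then halfDiff {b} y else -halfDiff {b} y) +
            (if Even (l : ℕ) then r y else -r y)| := by
        by_contra! h
        have h0 := h 0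
        have h1 := h 1
        have h2 := h 2
        have h3 := h 3
        rw [if_pos (by decide), if_pos (by decide), abs_lt] at h0
        rw [if_pos (by decide), if_neg (by decide), abs_lt] at h1
        rw [if_neg (by decide), if_pos (by decide), abs_lt] at h2
        rw [if_neg (by decide), if_neg (by decide), abs_lt] at h3
        rcases abs_cases (halfDiff {a} y) with ⟨ha, -⟩ | ⟨ha, -⟩ <;>
        rcases abs_cases (halfDiff {b} y) with ⟨hb, -⟩ | ⟨hb, -⟩ <;>
        rcases abs_cases (r y) with ⟨hr, -⟩ | ⟨hr, -⟩ <;>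
        rw [ha, hb, hr] at h0 h1 h2 h3 <;> linarith
      refine le_trans ?_ (norm_le_pi_norm (T y) l)
      rw [hT, norm_mul, Real.norm_of_nonneg hlam0.le]
      gcongr
      exact hl
    have hmk : ‖(relOn d F {w | w ⊂ {a, b}}).mkQ y‖ ≤
        |halfDiff {a} y| + |halfDiff {b} y| + |r y| := by
      obtain ⟨p, q, e, rfl⟩ := exists_eq_of_mem_pre_pair hFa.1 hFb.1 hc hy
      -- Subtracting the means leaves multiples of `e₁ - e₂` in the blocks; `cp` and `cq` are the
      -- multiples of `d a` and `d b` into which the relations convert the diagonal parts.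
      set mp : ℝ := (p 0 + p 1) / 2 with hmp
      set mq : ℝ := (q 0 + q 1) / 2 with hmq
      set cp : ℝ := mp / (lam * ‖d a‖) with hcp
      set cq : ℝ := mq / (lam * ‖d b‖) with hcq
      have hw : -(inc X {a} 2 (fun _ => lam * (cp * ga (d a))) - inX ι (cp • d a)) +
          -(inc X {b} 2 (fun _ => lam * (cq * gb (d b))) - inX ι (cq • d b)) ∈
          relOn d F {w | w ⊂ {a, b}} :=
        add_mem
          (neg_mem (rel_le_relOn (A := {w | w ⊂ {a, b}}) (singleton_ssubset_pair_left hab)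
            ((mem_rel_singleton hFa).2 ⟨cp, rfl⟩)))
          (neg_mem (rel_le_relOn (A := {w | w ⊂ {a, b}}) (singleton_ssubset_pair_right hab)
            ((mem_rel_singleton hFb).2 ⟨cq, rfl⟩)))
      have hmp' : lam * (cp * ga (d a)) = mp := by rw [hcp, ha]; field_simp
      have hmq' : lam * (cq * gb (d b)) = mq := by rw [hcq, hb]; field_simp
      rw [hmp', hmq'] at hw
      refine (Submodule.norm_mkQ_le_norm_add _ _ hw).trans ?_
      have hsplit : inc X {a} 2 p + inc X {b} 2 q + inX ι (e • d a) +
          (-(inc X {a} 2 (fun _ => mp) - inX ι (cp • d a)) +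
            -(inc X {b} 2 (fun _ => mq) - inX ι (cq • d b))) =
          inc X {a} 2 (p - fun _ => mp) + inc X {b} 2 (q - fun _ => mq) +
            inX ι ((e + cp + cq * c) • d a) := by
        rw [map_sub, map_sub, add_smul, add_smul, map_add, map_add, mul_smul, ← hc]
        abel
      have hrv : r (inc X {a} 2 p + inc X {b} 2 q + inX ι (e • d a)) =
          (e + cp + cq * c) * ‖d a‖ := by
        rw [hr, meanFunctional_apply]
        simp only [map_add, toX_inc, toX_inX, halfSum_inc_self, halfSum_inc_of_ne hst,
          halfSum_inc_of_ne hst.symm, halfSum_inX, zero_add, add_zero, map_smul, smul_eq_mul]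
        rw [← hmp, ← hmq, hcp, hcq, hε, hc, map_smul, ha, smul_eq_mul]
        rw [hc] at hnb
        field_simp
        ring
      rw [hsplit, hrv]
      simp only [map_add, halfDiff_inc_self, halfDiff_inc_of_ne hst,
          halfDiff_inc_of_ne hst.symm, halfDiff_inX, zero_add, add_zero]
      refine (norm_add₃_le).trans (add_le_add (add_le_add ?_ ?_) (le_of_eq ?_))
      · rw [norm_inc]
        exact norm_sub_mean_le p
      · rw [norm_inc]
        exact norm_sub_mean_le q
      · rw [norm_inX, norm_smul, abs_mul, abs_norm, Real.norm_eq_abs]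
    have h0 : 0 ≤ |halfDiff {a} y| + |halfDiff {b} y| + |r y| := by positivity
    have heta : 0 < eta := pos_of_mul_pos_right (by linarith) hlam0.le
    calc _ ≤ _ := hmk
      _ ≤ eta * (lam * (|halfDiff {a} y| + |halfDiff {b} y| + |r y|)) := by
        rw [← mul_assoc, mul_comm eta]
        exact le_mul_of_one_le_left h0 hle.le
      _ ≤ _ := by gcongr

/-- The conditions on the data at `t`: validity, and the special form at the singletons `{γ l}`
and, if `d (γ 1)` is a multiple of `d (γ 0)`, at the pair `{γ 0, γ 1}`. -/
structure IsGood (d : ι → X) (lam eta : ℝ) (γ : Fin 2 → ι) (g : Fin 2 → StrongDual ℝ X)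
    (t : Finset ι) (F : Finset ι → LocalData ι X) : Prop where
  admissible : IsAdmissible (relOn d F {w | w ⊂ t}) (pre d F t) lam eta (F t)
  single : ∀ l, t = {γ l} → IsSingle (g l) lam (F t)
  pair : t = {γ 0, γ 1} → (∃ c : ℝ, d (γ 1) = c • d (γ 0)) →
    IsPair {γ 0} {γ 1} (g 0) lam (g 0 (d (γ 1)) / ‖d (γ 1)‖) (F t)

theorem exists_forall_isGood {lam eta : ℝ} (hlam : 1 < lam) (hle : 1 < lam * eta)
    {γ : Fin 2 → ι} (hγ : StrictMono γ) (hd : ∀ l, d (γ l) ≠ 0) {g : Fin 2 → StrongDual ℝ X}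
    (hg : ∀ l, ‖g l‖ ≤ 1) (hgd : ∀ l, g l (d (γ l)) = ‖d (γ l)‖) :
    ∃ F : Finset ι → LocalData ι X, ∀ t, IsGood d lam eta γ g t F := by
  have hlam0 : 0 < lam := by linarith
  have h01 : γ 0 ≠ γ 1 := hγ.injective.ne (by decide)
  refine exists_forall_of_local (fun t F => IsGood d lam eta γ g t F) ?_ ?_
  · rintro t F F' h ⟨h1, h2, h3⟩
    rw [relOn_congr (A := {w | w ⊂ t}) (F' := F') fun a ha u hu => h u (hu.trans ha.subset),
      pre_congr (F' := F') fun u hu => h u hu.subset, h t le_rfl] at h1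
    rw [h t le_rfl] at h2 h3
    exact ⟨h1, h2, h3⟩
  · intro t F hF
    have key : ∀ D : LocalData ι X,
        IsAdmissible (relOn d F {w | w ⊂ t}) (pre d F t) lam eta D →
        (∀ l, t = {γ l} → IsSingle (g l) lam D) →
        (t = {γ 0, γ 1} → (∃ c : ℝ, d (γ 1) = c • d (γ 0)) →
          IsPair {γ 0} {γ 1} (g 0) lam (g 0 (d (γ 1)) / ‖d (γ 1)‖) D) →
        IsGood d lam eta γ g t (Function.update F t D) := by
      intro D h1 h2 h3
      have hF' : ∀ u, u ⊂ t → F u = Function.update F t D u := fun u hu =>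
        (Function.update_of_ne hu.ne _ _).symm
      rw [relOn_congr (A := {w | w ⊂ t}) (F' := Function.update F t D)
          fun a ha u hu => hF' u (lt_of_le_of_lt hu ha),
        pre_congr (F' := Function.update F t D) hF'] at h1
      refine ⟨?_, ?_, ?_⟩ <;> rw [Function.update_self]
      exacts [h1, h2, h3]
    have hpair : ∀ l, ({γ l} : Finset ι) ≠ {γ 0, γ 1} := fun l h => by
      have := congrArg card h
      rw [card_singleton, card_pair h01] at this
      omega
    by_cases hs : ∃ l, t = {γ l}
    · obtain ⟨l, rfl⟩ := hs
      obtain ⟨D, h1, h2⟩ := exists_isSingle (F := F) (γ l) (g l) (hgd l) hlam0 hle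
      refine ⟨D, key D h2 (fun m hm => ?_) fun h => absurd h (hpair l)⟩
      rwa [hγ.injective (singleton_injective hm)] at h1
    · push Not at hs
      by_cases hp : t = {γ 0, γ 1} ∧ ∃ c : ℝ, d (γ 1) = c • d (γ 0)
      · obtain ⟨rfl, c, hc⟩ := hp
        obtain ⟨D, h1, h2⟩ := exists_isPair (F := F) h01 (g 0) (g 1) (hg 0) (hgd 0) (hgd 1)
          (hd 0) (hd 1) hc hlam hle
          ((hF _ (singleton_ssubset_pair_left h01)).single 0 rfl)
          ((hF _ (singleton_ssubset_pair_right h01)).single 1 rfl)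
        exact ⟨D, key D h2 (fun l h => absurd h (hs l)) fun _ _ => h1⟩
      · obtain ⟨D, hD⟩ := exists_isAdmissible (relOn d F {w | w ⊂ t}) (pre d F t) hlam0 hle
        exact ⟨D, key D hD (fun l h => absurd h (hs l)) fun h h' => absurd ⟨h, h'⟩ hp⟩

end LocalData

end

/-! ### Recognizing a pushout by its norm. -/

/-- A space generated by an isometric copy of `E` and by the image of `ℓ_∞^n`, with the norm of the
pushout, is the pushout. -/
theorem exists_pushout_equiv {n : ℕ} {E Z : Type*} [NormedAddCommGroup E] [NormedSpace ℝ E]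
    [NormedAddCommGroup Z] [NormedSpace ℝ Z] (S : Submodule ℝ (Fin n → ℝ)) (ν : S →ₗ[ℝ] E)
    (i : (Fin n → ℝ) →ₗ[ℝ] Z) (j : E →ₗ[ℝ] Z) (hj : ∀ e, ‖j e‖ = ‖e‖) (hi : ∀ b, ‖i b‖ ≤ ‖b‖)
    (hν : ∀ ξ : S, i ξ = j (ν ξ)) (hsurj : ∀ z, ∃ b e, i b + j e = z)
    (hnorm : ∀ b e δ, ‖i b + j e‖ < δ → ∃ ξ : S, ‖b - ξ‖ + ‖e + ν ξ‖ < δ) :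
    ∃ g : KisliakovPushout S ν ≃ₗᵢ[ℝ] Z,
      (∀ x, g (KisliakovPushout.cls S ν x 0) = i x) ∧
        ∀ e, g (KisliakovPushout.cls S ν 0 e) = j e := by
  let Φ : WithLp 1 ((Fin n → ℝ) × E) →ₗ[ℝ] Z :=
    i.coprod j ∘ₗ (WithLp.linearEquiv 1 ℝ ((Fin n → ℝ) × E)).toLinearMap
  have hΦ : ∀ z, Φ z = i z.fst + j z.snd := fun z => rfl
  have hmem : ∀ ξ : S, WithLp.toLp 1 ((ξ : Fin n → ℝ), -ν ξ) ∈ pushoutRel S ν :=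
    fun ξ => ⟨ξ, rfl⟩
  have hle : pushoutRel S ν ≤ LinearMap.ker Φ := by
    rintro _ ⟨ξ, rfl⟩
    change i ξ + j (-ν ξ) = 0
    rw [hν, map_neg, add_neg_cancel]
  have hinj : ∀ z, Φ z = 0 → z ∈ pushoutRel S ν := by
    intro z hz
    rw [hΦ] at hz
    -- The norm condition at a vector of the kernel puts `z.fst` only in the closure of `S`; finite
    -- dimension makes `S` closed.
    have hS : z.fst ∈ S := by
      have hcl : IsClosed (S : Set (Fin n → ℝ)) := S.closed_of_finiteDimensional
      change z.fst ∈ (S : Set (Fin n → ℝ))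
      rw [← hcl.closure_eq]
      refine Metric.mem_closure_iff.2 fun δ hδ => ?_
      obtain ⟨ξ, hξ⟩ := hnorm z.fst z.snd δ (by rwa [hz, norm_zero])
      refine ⟨ξ, ξ.2, ?_⟩
      rw [dist_eq_norm]
      linarith [norm_nonneg (z.snd + ν ξ)]
    have h0 : z.snd = -ν ⟨z.fst, hS⟩ := by
      rw [eq_neg_iff_add_eq_zero, ← norm_eq_zero, ← hj, map_add, ← hν, add_comm, norm_eq_zero]
      exact hz
    have : z = WithLp.toLp 1 (z.fst, -ν ⟨z.fst, hS⟩) := by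
      rw [← h0]
      rfl
    rw [this]
    exact hmem ⟨z.fst, hS⟩
  have hnle : ∀ z, ‖Φ z‖ ≤ 1 * ‖z‖ := fun z => by
    rw [hΦ, one_mul, WithLp.prod_norm_eq_of_L1, ← hj z.snd]
    exact (norm_add_le _ _).trans (add_le_add (hi _) le_rfl)
  have hnorm' : ∀ z, ‖Φ z‖ = ‖(pushoutRel S ν).mkQ z‖ := by
    intro z
    refine le_antisymm ?_ (le_of_forall_gt fun δ hδ => ?_)
    · have := LocalData.norm_apply_le_mul_norm_mkQ (pushoutRel S ν) Φ one_pos hnle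
        (fun w hw => hle hw) z
      rwa [one_mul] at this
    · obtain ⟨ξ, hξ⟩ := hnorm z.fst z.snd δ (by rwa [← hΦ])
      refine (Submodule.norm_mkQ_le_norm_add _ z (neg_mem (hmem ξ))).trans_lt ?_
      rw [WithLp.prod_norm_eq_of_L1]
      have h1 : (z + -WithLp.toLp 1 ((ξ : Fin n → ℝ), -ν ξ)).fst = z.fst - ξ :=
        (sub_eq_add_neg _ _).symm
      have h2 : (z + -WithLp.toLp 1 ((ξ : Fin n → ℝ), -ν ξ)).snd = z.snd + ν ξ := by
        change z.snd + -(-ν ξ) = _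
        rw [neg_neg]
      rwa [h1, h2]
  let e : KisliakovPushout S ν ≃ₗ[ℝ] Z :=
    LinearEquiv.ofBijective ((pushoutRel S ν).liftQ Φ hle) ⟨by
      rw [← LinearMap.ker_eq_bot, Submodule.ker_liftQ_eq_bot' _ _ (le_antisymm hle hinj)], by
      intro z
      obtain ⟨b, e, h⟩ := hsurj z
      exact ⟨(pushoutRel S ν).mkQ (WithLp.toLp 1 (b, e)), h⟩⟩
  refine ⟨⟨e, fun x => ?_⟩, fun x => ?_, fun y => ?_⟩
  · obtain ⟨z, rfl⟩ := (pushoutRel S ν).mkQ_surjective x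
    exact hnorm' z
  · change i x + j 0 = i x
    rw [map_zero, add_zero]
  · change i 0 + j y = j y
    rw [map_zero, zero_add]

noncomputable section

/-- Restriction of the codomain to a submodule, `0` if the range is not contained in it. -/
def LinearMap.corestrict {M Z : Type*} [AddCommGroup M] [Module ℝ M] [AddCommGroup Z] [Module ℝ Z]
    (f : M →ₗ[ℝ] Z) (W : Submodule ℝ Z) : M →ₗ[ℝ] W :=
  -- The raw data require a map for every pair of indices, including pairs with no inclusion between
  -- the stages; there the value is the irrelevant 0.
  open Classical in if h : ∀ x, f x ∈ W then f.codRestrict W h else 0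

theorem LinearMap.coe_corestrict {M Z : Type*} [AddCommGroup M] [Module ℝ M] [AddCommGroup Z]
    [Module ℝ Z] {f : M →ₗ[ℝ] Z} {W : Submodule ℝ Z} (h : ∀ x, f x ∈ W) (x : M) :
    (f.corestrict W x : Z) = f x := by
  rw [corestrict, dif_pos h]
  rfl

theorem toColex_le_of_subset {ι : Type*} [LinearOrder ι] {s t : Finset ι} (h : s ⊆ t) :
    toColex s ≤ toColex t :=
  Finset.Colex.toColex_le_toColex_of_subset h

theorem antilexLE_refl {ι : Type u} [LinearOrder ι] (t : Finset ι) : antilexLE t t :=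
  le_rfl (a := toColex t)

theorem antilexLE_antilexPred {ι : Type u} [LinearOrder ι] {s t : Finset ι} (ht : t.Nonempty) :
    antilexLE (antilexPred s t) t :=
  (antilexPred_spec ht).2.1.le

theorem antilexLE.trans {ι : Type u} [LinearOrder ι] {s t w : Finset ι} (h : antilexLE s t)
    (h' : antilexLE t w) : antilexLE s w :=
  le_trans (α := Colex (Finset ι)) h h'

/-! ### Realizations made of subspaces of one common space. -/

namespace LopezAbadData

variable {ι : Type u} [LinearOrder ι] {X : Type v} [NormedAddCommGroup X] [NormedSpace ℝ X]
variable {Z : Type (max u v)} [NormedAddCommGroup Z] [NormedSpace ℝ Z]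
variable {n : Finset ι → ℕ}

/-- The subspace of `Z` spanned by the images of `X` and of the `ℓ_∞^{n_u}`, for the nonempty sets
`u ⊆ s` with `u ⪯ t`. -/
def stage (b : X →ₗᵢ[ℝ] Z) (I : ∀ t, (Fin (n t) → ℝ) →ₗ[ℝ] Z) (s t : Finset ι) : Submodule ℝ Z :=
  LinearMap.range b.toLinearMap ⊔
    ⨆ u : {u : Finset ι // u.Nonempty ∧ u ⊆ s ∧ antilexLE u t}, LinearMap.range (I u.1)

/-- The subspace of `Z` spanned by the images of `X_t` and of the `ℓ_∞^{n_u}`, for the nonempty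
sets `u ⊊ t`. -/
def accumulated (d : ι → X) (b : X →ₗᵢ[ℝ] Z) (I : ∀ t, (Fin (n t) → ℝ) →ₗ[ℝ] Z) (t : Finset ι) :
    Submodule ℝ Z :=
  (⨆ u : {u : Finset ι // u.Nonempty ∧ u ⊂ t}, LinearMap.range (I u.1)) ⊔
    (Submodule.span ℝ (d '' (t : Set ι))).map b.toLinearMap

variable (S : ∀ t : Finset ι, Submodule ℝ (Fin (n t) → ℝ)) (b : X →ₗᵢ[ℝ] Z)
variable (I : ∀ t, (Fin (n t) → ℝ) →ₗ[ℝ] Z)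

theorem base_mem_stage (s t : Finset ι) (x : X) : b x ∈ stage b I s t :=
  Submodule.mem_sup_left ⟨x, rfl⟩

variable {b I}

theorem apply_mem_stage {s t u : Finset ι} (hu : u.Nonempty) (hus : u ⊆ s) (hut : antilexLE u t)
    (x : Fin (n u) → ℝ) : I u x ∈ stage b I s t :=
  Submodule.mem_sup_right <|
    (le_iSup (fun u : {u : Finset ι // u.Nonempty ∧ u ⊆ s ∧ antilexLE u t} =>
      LinearMap.range (I u.1)) ⟨u, hu, hus, hut⟩) ⟨x, rfl⟩

theorem stage_le {s t : Finset ι} {P : Submodule ℝ Z} (hX : ∀ x, b x ∈ P)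
    (h : ∀ u : Finset ι, u.Nonempty → u ⊆ s → antilexLE u t → ∀ x, I u x ∈ P) :
    stage b I s t ≤ P := by
  refine sup_le ?_ (iSup_le ?_)
  · rintro _ ⟨x, rfl⟩
    exact hX x
  · rintro ⟨u, hu, hus, hut⟩ _ ⟨x, rfl⟩
    exact h u hu hus hut x

theorem stage_mono {s s' t t' : Finset ι} (hs : s ⊆ s') (ht : antilexLE t t') :
    stage b I s t ≤ stage b I s' t' :=
  stage_le (base_mem_stage b I _ _) fun _ hu hus hut =>
    apply_mem_stage hu (hus.trans hs) (hut.trans ht)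

/-- A proper subset of `t` precedes `t` in the order `≺`, so its block is already present at the
predecessor of `t`. -/
theorem accumulated_le_stage (d : ι → X) {s t : Finset ι} (hts : t ⊆ s) :
    accumulated d b I t ≤ stage b I s (antilexPred s t) := by
  refine sup_le (iSup_le ?_) ?_
  · rintro ⟨u, hu, hut⟩ _ ⟨x, rfl⟩
    have hus := hut.subset.trans hts
    exact apply_mem_stage hu hus ((antilexPred_spec (hu.mono hut.subset)).2.2 u hus
      (Finset.Colex.toColex_lt_toColex_of_ssubset hut)) x
  · rintro _ ⟨x, -, rfl⟩
    exact base_mem_stage b I _ _ x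

theorem stage_le_range_sup {s t : Finset ι} (ht : t.Nonempty) :
    stage b I s t ≤ LinearMap.range (I t) ⊔ stage b I s (antilexPred s t) := by
  refine stage_le (fun x => Submodule.mem_sup_right (base_mem_stage b I _ _ x))
    fun u hu hus hut x => ?_
  rcases (show toColex u ≤ toColex t from hut).eq_or_lt with h | h
  · obtain rfl : u = t := toColex_inj.1 h
    exact Submodule.mem_sup_left ⟨x, rfl⟩
  · exact Submodule.mem_sup_right (apply_mem_stage hu hus ((antilexPred_spec ht).2.2 u hus h) x)

variable (b I)

theorem stage_empty (s : Finset ι) : stage b I s ∅ = LinearMap.range b.toLinearMap := by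
  refine le_antisymm (stage_le (fun x => ⟨x, rfl⟩) fun u hu _ hu' => ?_) le_sup_left
  have : toColex u ≤ toColex ∅ := hu'
  exact absurd this (not_le.2 (Finset.Colex.toColex_lt_toColex_of_ssubset hu.empty_ssubset))

/-- The identification of `X` with `E_∅^{(s)}`. -/
def baseEquiv (s : Finset ι) : X ≃ₗᵢ[ℝ] stage b I s ∅ :=
  LinearIsometryEquiv.ofSurjective
    ⟨b.toLinearMap.codRestrict (stage b I s ∅) (base_mem_stage b I s ∅), b.norm_map⟩ (by
    rintro ⟨_, hz⟩
    obtain ⟨x, rfl⟩ := (stage_empty b I s).le hz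
    exact ⟨x, rfl⟩)

/-- The Lopez-Abad data consisting of subspaces of a common space `Z`. -/
@[reducible] def ofMaps : LopezAbadData.{u, v} ι X where
  n := n
  S := S
  E s t := stage b I s t
  base s := baseEquiv b I s
  ν s t := LinearMap.corestrict (I t ∘ₗ (S t).subtype) (stage b I s (antilexPred s t))
  i s t := LinearMap.corestrict (I t) (stage b I s t)
  j s u t := LinearMap.corestrict (stage b I s u).subtype (stage b I s t)
  k t s u := LinearMap.corestrict (stage b I t u).subtype (stage b I s u)

theorem coe_base (s : Finset ι) (x : X) : ((ofMaps S b I).base s x : Z) = b x := rfl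

theorem coe_i {s t : Finset ι} (hts : t ⊆ s) (ht : t.Nonempty) (x : Fin (n t) → ℝ) :
    ((ofMaps S b I).i s t x : Z) = I t x :=
  LinearMap.coe_corestrict (fun x => apply_mem_stage ht hts (antilexLE_refl t) x) x

theorem coe_j {s u t : Finset ι} (h : antilexLE u t) (x : (ofMaps S b I).E s u) :
    ((ofMaps S b I).j s u t x : Z) = (x : Z) :=
  LinearMap.coe_corestrict (fun x => stage_mono subset_rfl h x.2) x

theorem coe_k {t s u : Finset ι} (h : t ⊆ s) (x : (ofMaps S b I).E t u) :
    ((ofMaps S b I).k t s u x : Z) = (x : Z) :=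
  LinearMap.coe_corestrict (fun x => stage_mono h (antilexLE_refl u) x.2) x

theorem norm_j {s u t : Finset ι} (h : antilexLE u t) (x : (ofMaps S b I).E s u) :
    ‖(ofMaps S b I).j s u t x‖ = ‖x‖ :=
  congrArg norm (coe_j S b I h x)

theorem norm_k {t s u : Finset ι} (h : t ⊆ s) (x : (ofMaps S b I).E t u) :
    ‖(ofMaps S b I).k t s u x‖ = ‖x‖ :=
  congrArg norm (coe_k S b I h x)

theorem coe_glob {t s : Finset ι} (h : t ⊆ s) (x : (ofMaps S b I).E t t) :
    ((ofMaps S b I).glob t s x : Z) = (x : Z) := by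
  rw [LopezAbadData.glob, LinearMap.comp_apply, coe_j _ _ _ (toColex_le_of_subset h),
    coe_k _ _ _ h]

theorem map_subtype_Y (d : ι → X) {s t : Finset ι} (hts : t ⊆ s) :
    ((ofMaps S b I).Y d s t).map (stage b I s (antilexPred s t)).subtype =
      accumulated d b I t := by
  have hempty : antilexLE ∅ (antilexPred s t) := toColex_le_of_subset (empty_subset _)
  rw [LopezAbadData.Y, accumulated, Submodule.map_sup, Submodule.map_iSup]
  refine congrArg₂ _ (iSup_congr fun u => ?_) ?_
  · have hus := u.2.2.subset.trans hts
    have hpred : antilexLE u.1 (antilexPred s t) :=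
      (antilexPred_spec (u.2.1.mono u.2.2.subset)).2.2 u.1 hus
        (Finset.Colex.toColex_lt_toColex_of_ssubset u.2.2)
    rw [LopezAbadData.G, ← LinearMap.range_comp, ← LinearMap.range_comp]
    refine congrArg LinearMap.range (LinearMap.ext fun x => ?_)
    exact (coe_j S b I hpred _).trans (coe_i S b I hus u.2.1 x)
  · rw [← Submodule.map_comp]
    refine congrArg (fun f => Submodule.map f _) (LinearMap.ext fun x => ?_)
    exact coe_j S b I hempty _

theorem ofMaps_j_comp {s u t w : Finset ι} (hut : antilexLE u t) (htw : antilexLE t w) :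
    (ofMaps S b I).j s t w ∘ₗ (ofMaps S b I).j s u t = (ofMaps S b I).j s u w := by
  refine LinearMap.ext fun x => Subtype.ext ?_
  rw [LinearMap.comp_apply, coe_j S b I htw, coe_j S b I hut, coe_j S b I (hut.trans htw)]

theorem ofMaps_k_j {u w t s : Finset ι} (hts : t ⊆ s) (huw : antilexLE u w) :
    (ofMaps S b I).k t s w ∘ₗ (ofMaps S b I).j t u w = (ofMaps S b I).j s u w ∘ₗ (ofMaps S b I).k t s u := by
  refine LinearMap.ext fun x => Subtype.ext ?_
  rw [LinearMap.comp_apply, LinearMap.comp_apply, coe_k S b I hts, coe_j S b I huw,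
    coe_j S b I huw, coe_k S b I hts]

theorem ofMaps_k_i {u t s : Finset ι} (hu : u.Nonempty) (hut : u ⊆ t) (hts : t ⊆ s) (x : Fin (n u) → ℝ) :
    (ofMaps S b I).k t s u ((ofMaps S b I).i t u x) = (ofMaps S b I).i s u x := by
  refine Subtype.ext ?_
  rw [coe_k S b I hts, coe_i S b I hut hu, coe_i S b I (hut.trans hts) hu]

theorem ofMaps_k_base {t s : Finset ι} (hts : t ⊆ s) (x : X) :
    (ofMaps S b I).k t s ∅ ((ofMaps S b I).base t x) = (ofMaps S b I).base s x := by
  refine Subtype.ext ?_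
  rw [coe_k S b I hts, coe_base, coe_base]

theorem ofMaps_j_refl (s t : Finset ι) :
    (ofMaps S b I).j s t t = LinearMap.id := by
  refine LinearMap.ext fun x => Subtype.ext ?_
  rw [coe_j S b I (antilexLE_refl t), LinearMap.id_apply]

theorem coe_ν {d : ι → X} (hacc : ∀ t, (S t).map (I t) = accumulated d b I t) {s t : Finset ι}
    (hts : t ⊆ s) (ξ : S t) : ((ofMaps S b I).ν s t ξ : Z) = I t ξ :=
  LinearMap.coe_corestrict (f := I t ∘ₗ (S t).subtype) (W := stage b I s (antilexPred s t))
    (fun ξ => accumulated_le_stage d hts (hacc t ▸ Submodule.mem_map_of_mem ξ.2)) ξ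

theorem ofMaps_ν_range {d : ι → X} (hacc : ∀ t, (S t).map (I t) = accumulated d b I t)
    {s t : Finset ι} (hts : t ⊆ s) :
    LinearMap.range ((ofMaps S b I).ν s t) = (ofMaps S b I).Y d s t := by
  refine Submodule.map_injective_of_injective
    (stage b I s (antilexPred s t)).injective_subtype ?_
  rw [map_subtype_Y S b I d hts, ← hacc, ← LinearMap.range_comp]
  rw [← Submodule.range_subtype (S t), ← LinearMap.range_comp]
  exact congrArg LinearMap.range (LinearMap.ext fun ξ => coe_ν S b I hacc hts ξ)

theorem ofMaps_pushout {d : ι → X} (hacc : ∀ t, (S t).map (I t) = accumulated d b I t)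
    (hI : ∀ t x, ‖I t x‖ ≤ ‖x‖)
    (hnorm : ∀ s t, t ⊆ s → t.Nonempty → ∀ x, ∀ e ∈ stage b I s (antilexPred s t), ∀ δ,
      ‖I t x + e‖ < δ → ∃ ξ ∈ S t, ‖x - ξ‖ + ‖e + I t ξ‖ < δ)
    {s t : Finset ι} (hts : t ⊆ s) (ht : t.Nonempty) :
    ∃ g : KisliakovPushout (S t) ((ofMaps S b I).ν s t) ≃ₗᵢ[ℝ] (ofMaps S b I).E s t,
      (∀ x, g (KisliakovPushout.cls _ _ x 0) = (ofMaps S b I).i s t x) ∧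
      ∀ e, g (KisliakovPushout.cls _ _ 0 e) = (ofMaps S b I).j s (antilexPred s t) t e := by
  have hpred := antilexLE_antilexPred (s := s) ht
  refine exists_pushout_equiv (S t) ((ofMaps S b I).ν s t) ((ofMaps S b I).i s t)
    ((ofMaps S b I).j s (antilexPred s t) t) (norm_j S b I hpred) (fun x => ?_) (fun ξ => ?_)
    ?_ ?_
  · refine le_trans (le_of_eq ?_) (hI t x)
    exact congrArg norm (coe_i S b I hts ht x)
  · refine Subtype.ext ?_
    rw [coe_i S b I hts ht, coe_j S b I hpred, coe_ν S b I hacc hts]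
  · rintro ⟨z, hz⟩
    obtain ⟨_, ⟨x, rfl⟩, e, he, rfl⟩ := Submodule.mem_sup.1 (stage_le_range_sup ht hz)
    refine ⟨x, ⟨e, he⟩, Subtype.ext ?_⟩
    exact congrArg₂ (· + ·) (coe_i S b I hts ht x) (coe_j S b I hpred ⟨e, he⟩)
  · intro x e δ h
    have h' : ‖I t x + (e : Z)‖ < δ := by
      rw [← coe_i S b I hts ht x, ← coe_j S b I hpred e]
      exact h
    obtain ⟨ξ, hξ, hlt⟩ := hnorm s t hts ht x e e.2 δ h'
    refine ⟨⟨ξ, hξ⟩, lt_of_eq_of_lt ?_ hlt⟩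
    exact congrArg (‖x - ξ‖ + ·)
      (congrArg (fun z : Z => ‖(e : Z) + z‖) (coe_ν S b I hacc hts ⟨ξ, hξ⟩))

/-- A family of maps into a common space with the norm of the pushouts gives a realization. -/
theorem isRealization_ofMaps {d : ι → X} {lam eta : ℝ}
    (hproper : ∀ t, S t ≠ ⊤) (hacc : ∀ t, (S t).map (I t) = accumulated d b I t)
    (hle : ∀ t, ∀ ξ ∈ S t, ‖I t ξ‖ ≤ eta * ‖ξ‖) (hge : ∀ t, ∀ ξ ∈ S t, ‖ξ‖ ≤ lam * ‖I t ξ‖)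
    (hI : ∀ t x, ‖I t x‖ ≤ ‖x‖)
    (hnorm : ∀ s t, t ⊆ s → t.Nonempty → ∀ x, ∀ e ∈ stage b I s (antilexPred s t), ∀ δ,
      ‖I t x + e‖ < δ → ∃ ξ ∈ S t, ‖x - ξ‖ + ‖e + I t ξ‖ < δ) :
    (ofMaps S b I).IsRealization d lam eta where
  proper t _ := hproper t
  ν_range _ _ hts _ := ofMaps_ν_range S b I hacc hts
  ν_le _ t hts _ ξ :=
    (congrArg norm (coe_ν S b I hacc hts ξ)).le.trans (hle t ξ ξ.2)
  ν_ge _ t hts _ ξ :=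
    (hge t ξ ξ.2).trans_eq (congrArg (fun z : Z => lam * ‖z‖) (coe_ν S b I hacc hts ξ).symm)
  pushout _ _ hts ht := ofMaps_pushout S b I hacc hI hnorm hts ht
  j_refl s t _ := ofMaps_j_refl S b I s t
  j_comp _ _ _ _ _ _ _ hut htw := ofMaps_j_comp S b I hut htw
  j_isometry s u t _ _ hut :=
    AddMonoidHomClass.isometry_of_norm ((ofMaps S b I).j s u t) (norm_j S b I hut)
  k_isometry u t s _ hts :=
    AddMonoidHomClass.isometry_of_norm ((ofMaps S b I).k t s u) (norm_k S b I hts)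
  k_base _ _ hts x := ofMaps_k_base S b I hts x
  k_i _ _ _ hu hut hts x := ofMaps_k_i S b I hu hut hts x
  k_j _ _ _ _ _ _ hts huw := ofMaps_k_j S b I hts huw

end LopezAbadData

end

/-! ### The amalgam `Z` and the realization it carries. -/

noncomputable section

open Ambient

namespace LocalData

variable {ι : Type u} [LinearOrder ι] {X : Type v} [NormedAddCommGroup X] [NormedSpace ℝ X]
variable {d : ι → X} {F : Finset ι → LocalData ι X}

theorem exists_amalgam (d : ι → X) (F : Finset ι → LocalData ι X) :
    ∃ (Z : Type (max u v)) (_ : NormedAddCommGroup Z) (_ : NormedSpace ℝ Z)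
      (π : Ambient ι X →ₗ[ℝ] Z), Function.Surjective π ∧
        ∀ z, ‖π z‖ = ‖(relOn d F Set.univ).mkQ z‖ := by
  have hcl : IsClosed ((relOn d F Set.univ).topologicalClosure : Set (Ambient ι X)) :=
    Submodule.isClosed_topologicalClosure _
  exact ⟨Ambient ι X ⧸ (relOn d F Set.univ).topologicalClosure, inferInstance, inferInstance,
    (relOn d F Set.univ).topologicalClosure.mkQ, Submodule.mkQ_surjective _,
    Submodule.norm_mkQ_topologicalClosure _⟩

variable {Z : Type (max u v)} [NormedAddCommGroup Z] [NormedSpace ℝ Z]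
  {π : Ambient ι X →ₗ[ℝ] Z} (hπ : ∀ z, ‖π z‖ = ‖(relOn d F Set.univ).mkQ z‖)

include hπ

theorem norm_amalgam_le (z : Ambient ι X) : ‖π z‖ ≤ ‖z‖ :=
  (hπ z).trans_le (Submodule.norm_mkQ_le _ z)

theorem amalgam_inc_apply {t : Finset ι} {y : Ambient ι X} (hy : y ∈ pre d F t) :
    π (inc X t (F t).1 ((F t).2 y)) = π y := by
  rw [← sub_eq_zero, ← map_sub, ← norm_eq_zero, hπ]
  have : (relOn d F Set.univ).mkQ (inc X t (F t).1 ((F t).2 y) - y) = 0 :=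
    (Submodule.Quotient.mk_eq_zero _).2 (rel_le_relOn (Set.mem_univ t) ⟨y, hy, rfl⟩)
  rw [this, norm_zero]

theorem norm_amalgam_inX (hF : Expanding d F) (x : X) : ‖π (inX ι x)‖ = ‖x‖ := by
  rw [hπ, ← norm_mkQ_relOn_eq hF (A := ∅) isLowerSet_empty fun u _ n => coord_inX u n x]
  have : relOn d F ∅ = ⊥ := by simp [relOn]
  rw [this, Submodule.norm_mkQ_bot, norm_inX]

theorem norm_amalgam_eq (hF : Expanding d F) {t : Finset ι} {z : Ambient ι X}
    (hz : ∀ u, ¬ u ⊂ t → ∀ n, coord u n z = 0) :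
    ‖π z‖ = ‖(relOn d F {w | w ⊂ t}).mkQ z‖ := by
  have hlow : IsLowerSet {w : Finset ι | w ⊂ t} := fun _ _ hba ha => lt_of_le_of_lt hba ha
  rw [hπ, ← norm_mkQ_relOn_eq hF hlow hz]

/-- The sets not containing `t`, together with `t` itself, are closed under subsets, so by locality
only their relations matter. Only the one at `t` affects the block `t`, and splitting it off gives
the pushout norm. -/
theorem exists_norm_sub_add_norm_amalgam_lt (hF : Expanding d F) {t : Finset ι}
    (b : Fin (F t).1 → ℝ) {e : Ambient ι X} (he : ∀ u, t ⊆ u → ∀ n, coord u n e = 0) {δ : ℝ}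
    (h : ‖π (inc X t (F t).1 b + e)‖ < δ) :
    ∃ y ∈ pre d F t, ‖b - (F t).2 y‖ + ‖π (e + y)‖ < δ := by
  have hlow : IsLowerSet (insert t {u : Finset ι | ¬ t ⊆ u}) := by
    rintro a c hca (rfl | ha)
    · by_cases hac : a ⊆ c
      · exact Or.inl (subset_antisymm hca hac)
      · exact Or.inr hac
    · exact Or.inr fun htc => ha (htc.trans hca)
  rw [hπ, ← norm_mkQ_relOn_eq hF hlow] at h
  · obtain ⟨w, hw, hlt⟩ := Submodule.exists_norm_add_lt _ h
    obtain ⟨y, hy, w₀, hw₀, h'⟩ :=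
      exists_norm_inc_add_eq (fun a ha => ha) b (he t subset_rfl _) hw
    refine ⟨y, hy, lt_of_le_of_lt (add_le_add le_rfl ?_) (h' ▸ hlt)⟩
    rw [hπ]
    exact Submodule.norm_mkQ_le_norm_add _ _ (relOn_mono (Set.subset_univ _) hw₀)
  · intro u hu n
    have hne : u ≠ t := fun h => hu (Or.inl h)
    have htu : t ⊆ u := by
      by_contra h
      exact hu (Or.inr h)
    rw [map_add, coord_inc_of_ne hne, he u htu, add_zero]

/-- A functional that is contractive and compatible with the relations below `t` extends, without
increase of norm, from the space generated below `t` to the whole amalgam. -/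
theorem exists_extension (hF : Expanding d F) (hsurj : Function.Surjective π) {t : Finset ι}
    (φ : Ambient ι X →ₗ[ℝ] ℝ) (hφ : ∀ z, ‖φ z‖ ≤ 1 * ‖z‖)
    (hφ0 : ∀ w ∈ relOn d F {w | w ⊂ t}, φ w = 0) :
    ∃ g : StrongDual ℝ Z, ‖g‖ ≤ 1 ∧
      ∀ z, (∀ u, ¬ u ⊂ t → ∀ n, coord u n z = 0) → g (π z) = φ z := by
  let P : Submodule ℝ (Ambient ι X) :=
    ⨅ u : {u : Finset ι // ¬ u ⊂ t}, ⨅ n : ℕ, LinearMap.ker (coord u.1 n)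
  have hP : ∀ z, z ∈ P ↔ ∀ u, ¬ u ⊂ t → ∀ n, coord u n z = 0 := fun z => by
    simp only [P, Submodule.mem_iInf, LinearMap.mem_ker, Subtype.forall]
  have hle : ∀ z ∈ P, ‖φ z‖ ≤ ‖π z‖ := fun z hz => by
    rw [norm_amalgam_eq hπ hF ((hP z).1 hz), ← one_mul ‖(relOn d F {w | w ⊂ t}).mkQ z‖]
    exact norm_apply_le_mul_norm_mkQ _ φ one_pos hφ hφ0 z
  -- Hahn-Banach is applied upstairs with the seminorm `‖π z‖`. The extension then vanishes on the
  -- kernel of `π` and descends to `Z` through any linear section.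
  obtain ⟨ψ, hψ, hψle⟩ := exists_extension_of_le_sublinear ⟨P, φ.domRestrict P⟩
    (fun z => ‖π z‖) (fun c hc z => by rw [map_smul, norm_smul, Real.norm_of_nonneg hc.le])
    (fun x y => by rw [map_add]; exact norm_add_le _ _)
    (fun z => (le_abs_self _).trans (hle z z.2))
  have hψabs : ∀ z, |ψ z| ≤ ‖π z‖ := fun z => by
    refine abs_le'.2 ⟨hψle z, ?_⟩
    rw [← map_neg, ← norm_neg (π z), ← map_neg]
    exact hψle (-z)
  obtain ⟨r, hr⟩ := π.exists_rightInverse_of_surjective (LinearMap.range_eq_top.2 hsurj)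
  have hr' : ∀ z, π (r z) = z := fun z => LinearMap.congr_fun hr z
  have hrψ : ∀ z, ψ (r (π z)) = ψ z := fun z => by
    have := hψabs (r (π z) - z)
    rw [map_sub, map_sub, hr', sub_self, norm_zero] at this
    exact sub_eq_zero.1 (abs_eq_zero.1 (le_antisymm this (abs_nonneg _)))
  refine ⟨(ψ ∘ₗ r).mkContinuous 1 fun z => ?_, LinearMap.mkContinuous_norm_le _ zero_le_one _,
    fun z hz => ?_⟩
  · rw [one_mul, LinearMap.comp_apply]
    exact (hψabs (r z)).trans_eq (by rw [hr'])
  · rw [LinearMap.mkContinuous_apply, LinearMap.comp_apply, hrψ]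
    exact hψ ⟨z, (hP z).2 hz⟩

omit hπ

/-- The isometric embedding of `X` into the amalgam. -/
def base (hπ : ∀ z, ‖π z‖ = ‖(relOn d F Set.univ).mkQ z‖) (hF : Expanding d F) : X →ₗᵢ[ℝ] Z :=
  ⟨π ∘ₗ inX ι, norm_amalgam_inX hπ hF⟩

/-- The realization determined by a valid family of local data. -/
@[reducible] def system (hπ : ∀ z, ‖π z‖ = ‖(relOn d F Set.univ).mkQ z‖) (hF : Expanding d F) :
    LopezAbadData.{u, v} ι X :=
  LopezAbadData.ofMaps (fun t => (pre d F t).map (F t).2) (base hπ hF)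
    fun t => π ∘ₗ inc X t (F t).1

theorem system_isRealization (hπ : ∀ z, ‖π z‖ = ‖(relOn d F Set.univ).mkQ z‖)
    (hF : Expanding d F) {lam eta : ℝ}
    (hadm : ∀ t, IsAdmissible (relOn d F {w | w ⊂ t}) (pre d F t) lam eta (F t)) :
    (system hπ hF).IsRealization d lam eta := by
  have hpre : ∀ t, ∀ y ∈ pre d F t, ‖π y‖ = ‖(relOn d F {w | w ⊂ t}).mkQ y‖ := fun t y hy =>
    norm_amalgam_eq hπ hF fun u hu n => coord_eq_zero_of_mem_pre hu n hy
  refine LopezAbadData.isRealization_ofMaps _ _ _ (fun t => (hadm t).proper) ?_ ?_ ?_ ?_ ?_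
  · intro t
    have hacc : LopezAbadData.accumulated d (base hπ hF) (fun t => π ∘ₗ inc X t (F t).1) t =
        (pre d F t).map π := by
      rw [LopezAbadData.accumulated, pre, Submodule.map_sup, Submodule.map_iSup,
        ← Submodule.map_comp]
      simp only [LinearMap.range_comp]
      rfl
    rw [hacc, ← Submodule.map_comp]
    ext z
    simp only [Submodule.mem_map, LinearMap.comp_apply]
    exact exists_congr fun y => and_congr_right fun hy => by rw [amalgam_inc_apply hπ hy]
  · rintro t _ ⟨y, hy, rfl⟩
    rw [LinearMap.comp_apply, amalgam_inc_apply hπ hy, hpre t y hy]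
    exact (hadm t).le y hy
  · rintro t _ ⟨y, hy, rfl⟩
    rw [LinearMap.comp_apply, amalgam_inc_apply hπ hy, hpre t y hy]
    exact (hadm t).ge y hy
  · intro t x
    exact (norm_amalgam_le hπ _).trans_eq (norm_inc _ _ _)
  · intro s t hts ht x e he δ hlt
    -- A set strictly before `t` in `≺` cannot contain `t`, so the preceding stage lifts to vectors
    -- with no component at supersets of `t`.
    obtain ⟨e, hec, rfl⟩ : ∃ e', (∀ u, t ⊆ u → ∀ n, coord u n e' = 0) ∧ π e' = e := by
      let P : Submodule ℝ (Ambient ι X) :=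
        ⨅ u : {u : Finset ι // t ⊆ u}, ⨅ n : ℕ, LinearMap.ker (coord u.1 n)
      have hP : ∀ z, z ∈ P ↔ ∀ u, t ⊆ u → ∀ n, coord u n z = 0 := fun z => by
        simp only [P, Submodule.mem_iInf, LinearMap.mem_ker, Subtype.forall]
      have hle : LopezAbadData.stage (base hπ hF) (fun t => π ∘ₗ inc X t (F t).1) s
          (antilexPred s t) ≤ P.map π := by
        refine LopezAbadData.stage_le
          (fun y => ⟨inX ι y, (hP _).2 fun u _ n => coord_inX u n y, rfl⟩)
          fun w _ _ hw y => ⟨inc X w (F w).1 y, (hP _).2 fun u htu n => ?_, rfl⟩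
        refine coord_inc_of_ne ?_ _ _ _
        rintro rfl
        exact absurd ((toColex_le_of_subset htu).trans hw) (not_le.2 (antilexPred_spec ht).2.1)
      obtain ⟨e', h1, h2⟩ := hle he
      exact ⟨e', (hP e').1 h1, h2⟩
    rw [LinearMap.comp_apply, ← map_add] at hlt
    obtain ⟨y, hy, h⟩ := exists_norm_sub_add_norm_amalgam_lt hπ hF x hec hlt
    refine ⟨(F t).2 y, Submodule.mem_map_of_mem hy, ?_⟩
    rwa [LinearMap.comp_apply, amalgam_inc_apply hπ hy, ← map_add]

end LocalData

/-- The criterion used to exclude coordinate subspaces: a proper subspace containing a vector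
without zero entries is not one. -/
theorem IsCoordinateSubspace.eq_top {n : ℕ} {S : Submodule ℝ (Fin n → ℝ)}
    (h : IsCoordinateSubspace S) (hS : ∀ l, ∃ x ∈ S, x l ≠ 0) : S = ⊤ := by
  obtain ⟨I, rfl⟩ := h
  have hI : ∀ l, l ∈ I := fun l => by
    by_contra hl
    obtain ⟨x, hx, hxl⟩ := hS l
    suffices Submodule.span ℝ ((fun l => Pi.single l (1 : ℝ)) '' I) ≤
        LinearMap.ker (LinearMap.proj (R := ℝ) (φ := fun _ : Fin n => ℝ) l) from hxl (this hx)
    refine Submodule.span_le.2 ?_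
    rintro _ ⟨m, hm, rfl⟩
    exact Pi.single_eq_of_ne (fun e : l = m => hl (e ▸ hm)) 1
  rw [eq_top_iff]
  intro x _
  rw [pi_eq_sum_univ' x]
  exact Submodule.sum_mem _ fun l _ =>
    Submodule.smul_mem _ _ (Submodule.subset_span ⟨l, hI l, by ext; simp [Pi.single_apply, eq_comm]⟩)

theorem stdVec_zero_add_one {n : ℕ} (h : n = 2) : stdVec h 0 + stdVec h 1 = fun _ => 1 := by
  subst h
  ext l
  fin_cases l <;> simp [stdVec]

theorem stdVec_zero_add_one_four {n : ℕ} (h : n = 4) :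
    stdVec h 0 + stdVec h 1 = fun l : Fin n => if (l : ℕ) < 2 then (1 : ℝ) else 0 := by
  subst h
  ext l
  fin_cases l <;> simp [stdVec]

theorem stdVec_two_add_three_four {n : ℕ} (h : n = 4) :
    stdVec h 2 + stdVec h 3 = fun l : Fin n => if (l : ℕ) < 2 then (0 : ℝ) else 1 := by
  subst h
  ext l
  fin_cases l <;> simp [stdVec]

theorem norm_stdVec_sub_le {n : ℕ} (h : n = 2) : ‖stdVec h 0 - stdVec h 1‖ ≤ 1 := by
  subst h
  refine (pi_norm_le_iff_of_nonneg zero_le_one).2 (Fin.forall_fin_two.2 ⟨?_, ?_⟩) <;>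
    simp [stdVec]

theorem span_pair_smul_add_sub {V : Type*} [AddCommGroup V] [Module ℝ V] {c : ℝ} (hc : c ≠ 0)
    (x y : V) : Submodule.span ℝ {c • (x + y), c • (x - y)} = Submodule.span ℝ {x, y} := by
  refine le_antisymm (Submodule.span_le.2 ?_) (Submodule.span_le.2 ?_)
  · rintro _ (rfl | rfl)
    · exact Submodule.mem_span_pair.2 ⟨c, c, by module⟩
    · exact Submodule.mem_span_pair.2 ⟨c, -c, by module⟩
  · rintro _ (rfl | rfl)
    · refine Submodule.mem_span_pair.2 ⟨(2 * c)⁻¹, (2 * c)⁻¹, ?_⟩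
      rw [smul_smul, smul_smul, mul_inv, mul_assoc, inv_mul_cancel₀ hc]
      module
    · refine Submodule.mem_span_pair.2 ⟨(2 * c)⁻¹, -(2 * c)⁻¹, ?_⟩
      rw [smul_smul, smul_smul, neg_mul, mul_inv, mul_assoc, inv_mul_cancel₀ hc]
      module

namespace LocalData

variable {ι : Type u} [LinearOrder ι] {X : Type v} [NormedAddCommGroup X] [NormedSpace ℝ X]

theorem halfDiff_inc_of_eq (s : Finset ι) {n : ℕ} (h : n = 2) (b : Fin n → ℝ) :
    halfDiff s (inc X s n b) = (b (Fin.cast h.symm 0) - b (Fin.cast h.symm 1)) / 2 := by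
  subst h
  exact halfDiff_inc_self s b

theorem halfSum_inc_of_eq (s : Finset ι) {n : ℕ} (h : n = 2) (b : Fin n → ℝ) :
    halfSum s (inc X s n b) = (b (Fin.cast h.symm 0) + b (Fin.cast h.symm 1)) / 2 := by
  subst h
  exact halfSum_inc_self s b

end LocalData

end

/-! ### Computations with the prescribed stages, and the counterexample. -/

noncomputable section

open Ambient

theorem Set.range_fin_two {α : Type*} (f : Fin 2 → α) : Set.range f = {f 0, f 1} := by
  ext z
  simp [Fin.exists_fin_two, eq_comm]

namespace LocalData

variable {ι : Type u} [LinearOrder ι] {X : Type v} [NormedAddCommGroup X] [NormedSpace ℝ X]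
variable {d : ι → X} {F : Finset ι → LocalData ι X} {lam eta : ℝ} {γ : Fin 2 → ι}
  {g : Fin 2 → StrongDual ℝ X}

theorem expanding_of_isGood (heta : eta < 1) (hF : ∀ t, IsGood d lam eta γ g t F) :
    Expanding d F := fun u y hy =>
  ((hF u).admissible.le y hy).trans (mul_le_of_le_one_left (norm_nonneg _) heta.le)

theorem coord_eq_zero_of_singleton {a : ι} {t : Finset ι} (h : {a} ⊂ t) {u : Finset ι}
    (hu : ¬ u ⊂ t) (n m : ℕ) (b : Fin m → ℝ) : coord u n (inc X {a} m b) = 0 :=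
  coord_inc_of_ne (by rintro rfl; exact hu h) _ _ _

theorem halfDiff_stdVec (hn : ∀ l, (F {γ l}).1 = 2) (hγ : StrictMono γ) (l m : Fin 2) :
    halfDiff {γ l} (inc X {γ m} (F {γ m}).1 (stdVec (hn m) 0 - stdVec (hn m) 1)) =
      if l = m then 1 else 0 := by
  split_ifs with h
  · subst h
    rw [halfDiff_inc_of_eq _ (hn l)]
    simp [stdVec]
  · exact halfDiff_inc_of_ne (fun e => h (hγ.injective (singleton_injective e))) _ _

theorem halfSum_stdVec (hn : ∀ l, (F {γ l}).1 = 2) (hγ : StrictMono γ) (l m : Fin 2) :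
    halfSum {γ l} (inc X {γ m} (F {γ m}).1 (stdVec (hn m) 0 - stdVec (hn m) 1)) = 0 := by
  by_cases h : l = m
  · subst h
    rw [halfSum_inc_of_eq _ (hn l)]
    simp [stdVec]
  · exact halfSum_inc_of_ne (fun e => h (hγ.injective (singleton_injective e))) _ _

/-- The mean functional vanishes on `e₁ - e₂`, so only the sign pattern of the corresponding
`halfDiff` survives: `(+, +, +, +)` or `(+, +, -, -)`. -/
theorem apply_stdVec_of_isPair (hn : ∀ l, (F {γ l}).1 = 2) (hγ : StrictMono γ) {ε : ℝ}
    {D : LocalData ι X} (hD : IsPair {γ 0} {γ 1} (g 0) lam ε D) :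
    D.2 (inc X {γ 0} (F {γ 0}).1 (stdVec (hn 0) 0 - stdVec (hn 0) 1)) =
        lam • ((stdVec hD.1 0 + stdVec hD.1 1) + (stdVec hD.1 2 + stdVec hD.1 3)) ∧
      D.2 (inc X {γ 1} (F {γ 1}).1 (stdVec (hn 1) 0 - stdVec (hn 1) 1)) =
        lam • ((stdVec hD.1 0 + stdVec hD.1 1) - (stdVec hD.1 2 + stdVec hD.1 3)) := by
  rw [stdVec_zero_add_one_four, stdVec_two_add_three_four]
  constructor <;> ext l <;> rw [hD.2] <;>
  simp only [meanFunctional_apply, halfDiff_stdVec hn hγ, halfSum_stdVec hn hγ, toX_inc] <;>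
  by_cases h : (l : ℕ) < 2 <;>
  simp only [h, if_true, if_false, Pi.smul_apply, Pi.add_apply, Pi.sub_apply, smul_eq_mul] <;>
  norm_num

theorem map_singleton_eq_span {lam : ℝ} (hlam : 0 < lam) {a : ι} (hda : d a ≠ 0)
    {g : StrongDual ℝ X} (hg : g (d a) = ‖d a‖) {D : LocalData ι X} (hD : IsSingle g lam D) :
    (pre d F {a}).map D.2 = Submodule.span ℝ {stdVec hD.1 0 + stdVec hD.1 1} := by
  have hne : lam * ‖d a‖ ≠ 0 := mul_ne_zero hlam.ne' (norm_ne_zero_iff.2 hda)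
  have h : D.2 (inX ι (d a)) = (lam * ‖d a‖) • (stdVec hD.1 0 + stdVec hD.1 1) := by
    rw [stdVec_zero_add_one]
    ext l
    rw [hD.2, toX_inX, hg]
    simp
  rw [pre_singleton, Submodule.map_span, Set.image_singleton, h,
    Submodule.span_singleton_smul_eq (isUnit_iff_ne_zero.2 hne)]

end LocalData

end

open LocalData Ambient in
theorem proposition9p3 {ι : Type u} [LinearOrder ι] {X : Type v}
    [NormedAddCommGroup X] [NormedSpace ℝ X] [CompleteSpace X]
    (d : ι → X) (lam eta : ℝ)
    (hlam : 1 < lam) (hlam2 : lam < Real.sqrt 2) (heta : eta < 1) (hle : 1 < lam * eta)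
    (γ : Fin 2 → ι) (hγ : StrictMono γ) (hd : ∀ l, d (γ l) ≠ 0) :
    ∃ R : LopezAbadData.{u, v} ι X, R.IsRealization d lam eta ∧
    -- the singleton stages: `n = 2`, `S = span {e₁ + e₂}`, which is not a coordinate subspace
    ∃ hn : ∀ l, R.n {γ l} = 2,
      (∀ l, R.S {γ l} = Submodule.span ℝ {stdVec (hn l) 0 + stdVec (hn l) 1}) ∧
      (∀ l, ¬ IsCoordinateSubspace (R.S {γ l})) ∧
    -- the vectors `v_l = [(e₁ - e₂, 0)]` and the functionals `f_l [(b, e)] = (b₁ - b₂) / 2`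
    ∃ v : ∀ l, R.E {γ l} {γ l}, ∃ f : ∀ l, R.E {γ l} {γ l} →L[ℝ] ℝ,
      (∀ l, v l = R.i {γ l} {γ l} (stdVec (hn l) 0 - stdVec (hn l) 1)) ∧
      (∀ l b e, f l (R.i {γ l} {γ l} b + R.j {γ l} ∅ {γ l} e) =
        (b (Fin.cast (hn l).symm 0) - b (Fin.cast (hn l).symm 1)) / 2) ∧
      (∀ l, ‖f l‖ = 1 ∧ f l (v l) = 1 ∧ ‖v l‖ ≤ lam) ∧
    -- the functionals extend to `E_σ`, biorthogonally to the images of the `v_l`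
    (∃ F : Fin 2 → (R.E {γ 0, γ 1} {γ 0, γ 1} →L[ℝ] ℝ),
      (∀ l z, F l (R.glob {γ l} {γ 0, γ 1} z) = f l z) ∧
      (∀ l, ‖F l‖ ≤ lam * (1 + eta)) ∧
      ∀ l m, F l (R.glob {γ m} {γ 0, γ 1} (v m)) = if l = m then 1 else 0) ∧
    -- failure of the upper bound
    2 / lam ≤ ‖∑ l, R.glob {γ l} {γ 0, γ 1} (v l)‖ ∧
    lam < 2 / lam ∧
    (¬ ∀ a : Fin 2 → ℝ,
      ‖∑ l, a l • R.glob {γ l} {γ 0, γ 1} (v l)‖ ≤ lam * ⨆ l, |a l|) ∧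
    -- if `d (γ 0)`, `d (γ 1)` are proportional: `n_σ = 4`, and the span of the images of
    -- `v_1, v_2` corresponds to `span {e₁ + e₂, e₃ + e₄} ⊆ S_σ`
    ((∃ c : ℝ, d (γ 1) = c • d (γ 0)) →
      ∃ h4 : R.n {γ 0, γ 1} = 4,
        ¬ IsCoordinateSubspace (R.S {γ 0, γ 1}) ∧
        Submodule.span ℝ {stdVec h4 0 + stdVec h4 1, stdVec h4 2 + stdVec h4 3}
          ≤ R.S {γ 0, γ 1} ∧
        (Submodule.span ℝ {stdVec h4 0 + stdVec h4 1, stdVec h4 2 + stdVec h4 3}).map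
            (R.i {γ 0, γ 1} {γ 0, γ 1}) =
          Submodule.span ℝ (Set.range fun l => R.glob {γ l} {γ 0, γ 1} (v l))) := by
  have hlam0 : 0 < lam := by linarith
  have heta0 : 0 < eta := pos_of_mul_pos_right (by linarith) hlam0.le
  choose g hg hgd using fun l => exists_dual_vector'' ℝ (d (γ l))
  obtain ⟨F, hF⟩ := exists_forall_isGood hlam hle hγ hd hg hgd
  have hexp := expanding_of_isGood heta hF
  obtain ⟨Z, _, _, π, hsurj, hπ⟩ := exists_amalgam d F
  have hsingle : ∀ l, IsSingle (g l) lam (F {γ l}) := fun l => (hF {γ l}).single l rfl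
  have hn : ∀ l, (F {γ l}).1 = 2 := fun l => (hsingle l).1
  have hS : ∀ l, (pre d F {γ l}).map (F {γ l}).2 =
      Submodule.span ℝ {stdVec (hn l) 0 + stdVec (hn l) 1} := fun l =>
    map_singleton_eq_span hlam0 (hd l) (hgd l) (hsingle l)
  have h01 : γ 0 ≠ γ 1 := hγ.injective.ne (by decide)
  have hss : ∀ l, ({γ l} : Finset ι) ⊂ {γ 0, γ 1} := Fin.forall_fin_two.2
    ⟨singleton_ssubset_pair_left h01, singleton_ssubset_pair_right h01⟩
  set y : Fin 2 → Ambient ι X := fun l =>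
    inc X {γ l} (F {γ l}).1 (stdVec (hn l) 0 - stdVec (hn l) 1) with hy
  have hysupp : ∀ l u, ¬ u ⊂ ({γ 0, γ 1} : Finset ι) → ∀ n, coord u n (y l) = 0 :=
    fun l u hu n => coord_eq_zero_of_singleton (hss l) hu _ _ _
  have hφ0 : ∀ l, ∀ w ∈ relOn d F {w | w ⊂ {γ 0, γ 1}}, halfDiff {γ l} w = 0 := fun l =>
    apply_eq_zero_of_mem_relOn_pair _ (halfDiff_eq_zero_of_mem_rel_singleton (hsingle 0))
      (halfDiff_eq_zero_of_mem_rel_singleton (hsingle 1))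
  have hφle : ∀ z : Ambient ι X, |halfDiff {γ 0} z| + |halfDiff {γ 1} z| ≤ ‖z‖ := fun z => by
    have h1 := abs_halfDiff_add_abs_halfSum_le {γ 0} z
    have h2 := abs_halfDiff_add_abs_halfSum_le {γ 1} z
    have h3 := norm_toX_add_norm_coord_le ((singleton_injective).ne h01) z
    linarith [norm_nonneg (toX z), abs_nonneg (halfSum {γ 0} z), abs_nonneg (halfSum {γ 1} z)]
  have hφle' : ∀ l, ∀ z : Ambient ι X, ‖halfDiff {γ l} z‖ ≤ 1 * ‖z‖ := fun l z => by
    have h := hφle z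
    have h0 := abs_nonneg (halfDiff {γ 0} z)
    have h1 := abs_nonneg (halfDiff {γ 1} z)
    rw [one_mul, Real.norm_eq_abs]
    fin_cases l
    · exact (le_add_of_nonneg_right h1).trans h
    · exact (le_add_of_nonneg_left h0).trans h
  -- One contractive functional on `Z` serves for each index: its restrictions to `E_{s_l}` and to
  -- `E_σ` are `f_l` and `F_l`, so compatibility is immediate.
  choose G hG hGπ using fun l =>
    exists_extension hπ hexp hsurj (t := {γ 0, γ 1}) (halfDiff {γ l}) (hφle' l) (hφ0 l)
  have hGy : ∀ l m, G l (π (y m)) = if l = m then 1 else 0 := fun l m =>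
    (hGπ l _ (hysupp m)).trans (halfDiff_stdVec hn hγ l m)
  -- The sum of the two `halfDiff` is contractive and kills the relations below the pair; by
  -- locality no other relation affects this norm.
  have hsum : 2 ≤ ‖π (y 0) + π (y 1)‖ := by
    have hsupp : ∀ u, ¬ u ⊂ ({γ 0, γ 1} : Finset ι) → ∀ n, coord u n (y 0 + y 1) = 0 :=
      fun u hu n => by rw [map_add, hysupp 0 u hu, hysupp 1 u hu, add_zero]
    have h := norm_apply_le_mul_norm_mkQ (relOn d F {w | w ⊂ {γ 0, γ 1}})
      (halfDiff {γ 0} + halfDiff {γ 1}) one_pos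
      (fun z => by
        rw [one_mul]
        exact (abs_add_le _ _).trans (hφle z))
      (fun w hw => by rw [LinearMap.add_apply, hφ0 0 w hw, hφ0 1 w hw, add_zero]) (y 0 + y 1)
    rw [one_mul, ← norm_amalgam_eq hπ hexp hsupp, map_add π] at h
    refine le_trans (le_of_eq ?_) h
    simp only [LinearMap.add_apply, map_add, hy, halfDiff_stdVec hn hγ]
    norm_num
  have hlt : lam < 2 / lam := by
    rw [lt_div_iff₀ hlam0, ← sq]
    exact (Real.lt_sqrt hlam0.le).1 hlam2
  have h2 : 2 / lam ≤ 2 := div_le_self zero_le_two hlam.le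
  have hi : ∀ s t : Finset ι, t ⊆ s → t.Nonempty → ∀ b,
      ((system hπ hexp).i s t b : Z) = π (inc X t (F t).1 b) := fun s t hts ht b =>
    LopezAbadData.coe_i _ _ _ hts ht b
  have hglob : ∀ (l : Fin 2) (z : (system hπ hexp).E {γ l} {γ l}),
      ((system hπ hexp).glob {γ l} {γ 0, γ 1} z : Z) = (z : Z) := fun l z =>
    LopezAbadData.coe_glob _ _ _ (hss l).subset z
  have hv : ∀ l, ((system hπ hexp).i {γ l} {γ l} (stdVec (hn l) 0 - stdVec (hn l) 1) : Z) =
      π (y l) := fun l => hi _ _ subset_rfl (singleton_nonempty _) _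
  have hgv : ∀ l, ((system hπ hexp).glob {γ l} {γ 0, γ 1}
      ((system hπ hexp).i {γ l} {γ l} (stdVec (hn l) 0 - stdVec (hn l) 1)) : Z) =
      π (y l) := fun l => (hglob l _).trans (hv l)
  have hnormv : ∀ l, ‖π (y l)‖ ≤ 1 := fun l =>
    (norm_amalgam_le hπ _).trans ((norm_inc _ _ _).trans_le (norm_stdVec_sub_le (hn l)))
  have hle_two : 2 / lam ≤ ‖∑ l, (system hπ hexp).glob {γ l} {γ 0, γ 1}
      ((system hπ hexp).i {γ l} {γ l} (stdVec (hn l) 0 - stdVec (hn l) 1))‖ := by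
    rw [Fin.sum_univ_two]
    refine h2.trans (hsum.trans_eq ?_)
    exact congrArg norm (congrArg₂ (· + ·) (hgv 0) (hgv 1)).symm
  have hf : ∀ l b e, G l (((system hπ hexp).i {γ l} {γ l} b + (system hπ hexp).j {γ l} ∅ {γ l} e :
      (system hπ hexp).E {γ l} {γ l}) : Z) =
      (b (Fin.cast (hn l).symm 0) - b (Fin.cast (hn l).symm 1)) / 2 := by
    intro l b e
    obtain ⟨x, rfl⟩ := ((system hπ hexp).base {γ l}).surjective e
    have hz : (((system hπ hexp).i {γ l} {γ l} b + (system hπ hexp).j {γ l} ∅ {γ l}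
        ((system hπ hexp).base {γ l} x) : (system hπ hexp).E {γ l} {γ l}) : Z) =
        π (inc X {γ l} (F {γ l}).1 b + inX ι x) := by
      rw [map_add]
      exact congrArg₂ (· + ·) (hi _ _ subset_rfl (singleton_nonempty _) b)
        (LopezAbadData.coe_j _ _ _ (toColex_le_of_subset (empty_subset _)) _)
    rw [hz, hGπ, map_add, halfDiff_inX, add_zero, halfDiff_inc_of_eq _ (hn l)]
    intro u hu n
    rw [map_add, coord_inX, add_zero]
    exact coord_eq_zero_of_singleton (hss l) hu _ _ _
  have hGle : ∀ l (W : Submodule ℝ Z), ‖(G l).comp W.subtypeL‖ ≤ 1 := fun l W =>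
    ContinuousLinearMap.opNorm_le_bound _ zero_le_one fun z => (G l).le_of_opNorm_le (hG l) z
  refine ⟨system hπ hexp, system_isRealization hπ hexp fun t => (hF t).admissible, hn, hS,
    fun l hc => ((hF {γ l}).admissible.proper) (hc.eq_top fun k => ?_),
    fun l => (system hπ hexp).i {γ l} {γ l} (stdVec (hn l) 0 - stdVec (hn l) 1),
    fun l => (G l).comp (Submodule.subtypeL _), fun _ => rfl, hf, fun l => ?_,
    ⟨fun l => (G l).comp (Submodule.subtypeL _), ?_, ?_, ?_⟩, hle_two, hlt, ?_, ?_⟩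
  · refine ⟨stdVec (hn l) 0 + stdVec (hn l) 1, ?_, ?_⟩
    · rw [show (system hπ hexp).S {γ l} = _ from hS l]
      exact Submodule.mem_span_singleton_self _
    · rw [stdVec_zero_add_one]
      exact one_ne_zero
  · have hfv : G l ((system hπ hexp).i {γ l} {γ l} (stdVec (hn l) 0 - stdVec (hn l) 1) : Z) = 1 :=
      (congrArg (G l) (hv l)).trans ((hGy l l).trans (if_pos rfl))
    have hvle : ‖(system hπ hexp).i {γ l} {γ l} (stdVec (hn l) 0 - stdVec (hn l) 1)‖ ≤ 1 :=
      (congrArg norm (hv l)).trans_le (hnormv l)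
    refine ⟨le_antisymm (hGle l _) ?_, hfv, hvle.trans hlam.le⟩
    have h := ((G l).comp (Submodule.subtypeL _)).le_opNorm
      ((system hπ hexp).i {γ l} {γ l} (stdVec (hn l) 0 - stdVec (hn l) 1))
    refine le_trans (le_of_eq ?_) (h.trans (mul_le_of_le_one_right (norm_nonneg _) hvle))
    exact (norm_one (α := ℝ)).symm.trans (congrArg norm hfv.symm)
  · intro l z
    exact congrArg (G l) (hglob l z)
  · intro l
    refine (hGle l _).trans ?_
    -- The norm is in fact at most 1, and `1 < λ ≤ λ(1 + η)`.
    rw [mul_add, mul_one]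
    linarith
  · intro l m
    exact (congrArg (G l) (hgv m)).trans (hGy l m)
  · intro h
    have h1 := h fun _ => 1
    simp only [one_smul, abs_one, ciSup_const, mul_one] at h1
    exact absurd (hlt.trans_le hle_two) (not_lt.2 h1)
  · rintro ⟨c, hc⟩
    have hpair := (hF {γ 0, γ 1}).pair rfl ⟨c, hc⟩
    obtain ⟨hT0, hT1⟩ := apply_stdVec_of_isPair hn hγ hpair
    have hypre : ∀ l, y l ∈ pre d F {γ 0, γ 1} := fun l =>
      inc_mem_pre (singleton_nonempty _) (hss l) _
    have hspan : Submodule.span ℝ {stdVec hpair.1 0 + stdVec hpair.1 1,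
        stdVec hpair.1 2 + stdVec hpair.1 3} =
        Submodule.span ℝ {(F {γ 0, γ 1}).2 (y 0), (F {γ 0, γ 1}).2 (y 1)} := by
      rw [hT0, hT1, span_pair_smul_add_sub hlam0.ne']
    have hleS : Submodule.span ℝ {stdVec hpair.1 0 + stdVec hpair.1 1,
        stdVec hpair.1 2 + stdVec hpair.1 3} ≤ (pre d F {γ 0, γ 1}).map (F {γ 0, γ 1}).2 := by
      rw [hspan]
      refine Submodule.span_le.2 ?_
      rintro _ (rfl | rfl)
      · exact Submodule.mem_map_of_mem (hypre 0)
      · exact Submodule.mem_map_of_mem (hypre 1)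
    -- The relation at the pair identifies the image of `v_l` with the class of `T (y l)` in `ℓ_∞⁴`.
    have hiT : ∀ l, (system hπ hexp).i {γ 0, γ 1} {γ 0, γ 1} ((F {γ 0, γ 1}).2 (y l)) =
        (system hπ hexp).glob {γ l} {γ 0, γ 1}
          ((system hπ hexp).i {γ l} {γ l} (stdVec (hn l) 0 - stdVec (hn l) 1)) := fun l =>
      Subtype.ext ((hi _ _ subset_rfl (insert_nonempty _ _) _).trans
        ((amalgam_inc_apply hπ (hypre l)).trans (hgv l).symm))
    refine ⟨hpair.1, fun hco => (hF {γ 0, γ 1}).admissible.proper (hco.eq_top fun k =>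
      ⟨(F {γ 0, γ 1}).2 (y 0), Submodule.mem_map_of_mem (hypre 0), ?_⟩), hleS, ?_⟩
    -- The image of `y 0` is `λ(1, 1, 1, 1)`, which has no zero entry.
    · rw [hT0, stdVec_zero_add_one_four, stdVec_two_add_three_four]
      by_cases h : (k : ℕ) < 2 <;>
      simp only [h, if_true, if_false, Pi.smul_apply, Pi.add_apply, smul_eq_mul] <;>
      linarith
    · rw [hspan, Submodule.map_span, Set.image_pair, hiT, hiT]
      exact congrArg (Submodule.span ℝ) (Set.range_fin_two fun l => (system hπ hexp).glob {γ l} {γ 0, γ 1}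
        ((system hπ hexp).i {γ l} {γ l} (stdVec (hn l) 0 - stdVec (hn l) 1))).symm
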